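/- **Proposition 1.3.** Let $V\subset\mathbb P^r$ be an irreducible projective variety over $\mathbb C$ of dimension $n$ that is nondegenerate (not contained in a hyperplane), and let $k,h$ be integers with $0\le k\le h\le r$. For an irreducible projective variety $X\subset\mathbb P^N$ let $\mathrm{Sec}_h(X)\subset\mathbb P^N$ be the Zariski closure of the set of points lying in the span of $h+1$ linearly independent points of $X$. We say that $X$ is *$h$-defective* if $\dim \mathrm{Sec}_h(X)<\min\{(\dim X+1)(h+1)-1,\;N\}$; its *$h$-defect* is then $$\delta_h(X)=\min\{(\dim X+1)(h+1)-1,\;N\}-\dim\mathrm{Sec}_h(X).$$ Let $\mathbb G(k,r)$ be the Grassmannian of $k$-dimensional linear subspaces of $\mathbb P^r$, and let $\mathrm{Sec}_{k,h}(V)\subset\mathbb G(k,r)$ be the Zariski closure of the set of those subspaces $l\in\mathbb G(k,r)$ that lie in the span of $h+1$ linearly independent points of $V$. We say that $V$ is *$(k,h)$-Grassmann defective* if $\dim\mathrm{Sec}_{k,h}(V)<\min\{(h+1)n+(k+1)(h-k),\;(k+1)(r-k)\}$; its *$(k,h)$-defect* is then $$\delta_{k,h}(V)=\min\{(h+1)n+(k+1)(h-k),\;(k+1)(r-k)\}-\dim\mathrm{Sec}_{k,h}(V).$$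 Let $\sigma:\mathbb P^k\times V\to\mathbb P^{r(k+1)+k}$, $\big((\lambda_0:\dots:\lambda_k),p\big)\mapsto(\lambda_0p:\dots:\lambda_kp)$, be the Segre embedding. Then, for every integer $\delta$, $V$ is $(k,h)$-Grassmann defective with $\delta_{k,h}(V)=\delta$ if and only if $\sigma(\mathbb P^k\times V)$ is $h$-defective with $\delta_h(\sigma(\mathbb P^k\times V))=\delta$. -/

import Mathlib

open scoped LinearAlgebra.Projectivization

noncomputable section

namespace GrassmannDefect

/-! Classical complex projective geometry in homogeneous coordinates. For a finite index type `ι`,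
`ℙ ℂ (ι → ℂ)` is the projective space of dimension `card ι - 1` with homogeneous coordinates
indexed by `ι`; in particular `ℙ ℂ (Fin (r + 1) → ℂ)` is `P^r`. -/

section Zariski

variable {ι : Type*}

/-- The common zeros in projective space of a set of polynomials. It is used only for sets of
homogeneous polynomials, for which it does not depend on the representatives of the points. -/
def projZeroLocus (S : Set (MvPolynomial ι ℂ)) : Set (ℙ ℂ (ι → ℂ)) :=
  {p | ∀ f ∈ S, MvPolynomial.eval p.rep f = 0}

/-- Algebraic sets: the common zeros of a set of homogeneous polynomials. -/
def IsProjAlgebraic (X : Set (ℙ ℂ (ι → ℂ))) : Prop :=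
  ∃ S : Set (MvPolynomial ι ℂ), (∀ f ∈ S, ∃ d, f.IsHomogeneous d) ∧ X = projZeroLocus S

/-- The Zariski topology on projective space: the closed sets are the algebraic sets. -/
instance zariskiTopology (ι : Type*) : TopologicalSpace (ℙ ℂ (ι → ℂ)) :=
  TopologicalSpace.ofClosed {X | IsProjAlgebraic X}
    (by
      refine ⟨{1}, ?_, ?_⟩
      · rintro f rfl
        exact ⟨0, MvPolynomial.isHomogeneous_one _ _⟩
      · ext p
        simp [projZeroLocus])
    (by
      intro A hA
      have hA' : ∀ X ∈ A, ∃ S : Set (MvPolynomial ι ℂ),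
          (∀ f ∈ S, ∃ d, f.IsHomogeneous d) ∧ X = projZeroLocus S := fun X hX => hA hX
      choose! S hS hAS using hA'
      refine ⟨⋃ X ∈ A, S X, ?_, ?_⟩
      · intro f hf
        simp only [Set.mem_iUnion] at hf
        obtain ⟨X, hX, hf⟩ := hf
        exact hS X hX f hf
      · ext p
        simp only [Set.mem_sInter, projZeroLocus, Set.mem_iUnion, Set.mem_ofPred_eq]
        constructor
        · rintro h f ⟨X, hX, hf⟩
          have := h X hX
          rw [hAS X hX] at this
          exact this f hf
        · intro h X hX
          rw [hAS X hX]
          exact fun f hf => h f ⟨X, hX, hf⟩)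
    (by
      rintro _ ⟨S, hS, rfl⟩ _ ⟨T, hT, rfl⟩
      refine ⟨{f | ∃ a ∈ S, ∃ b ∈ T, f = a * b}, ?_, ?_⟩
      · rintro _ ⟨a, ha, b, hb, rfl⟩
        obtain ⟨d, hd⟩ := hS a ha
        obtain ⟨e, he⟩ := hT b hb
        exact ⟨d + e, hd.mul he⟩
      · ext p
        simp only [projZeroLocus, Set.mem_union, Set.mem_ofPred_eq]
        constructor
        · rintro (h | h) _ ⟨a, ha, b, hb, rfl⟩
          · simp [h a ha]
          · simp [h b hb]
        · intro h
          by_contra! hc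
          obtain ⟨⟨a, ha, ha'⟩, b, hb, hb'⟩ := hc
          have := h _ ⟨a, ha, b, hb, rfl⟩
          rw [map_mul] at this
          exact (mul_ne_zero ha' hb') this)

/-- The affine cone over a subset of projective space (it always contains the origin). -/
def affineCone (X : Set (ℙ ℂ (ι → ℂ))) : Set (ι → ℂ) :=
  {v | ∀ hv : v ≠ 0, Projectivization.mk ℂ v hv ∈ X}

/-- The homogeneous coordinate ring of `X`, that is, the ring of polynomial functions on the
affine cone over `X`. -/
abbrev CoordRing (X : Set (ℙ ℂ (ι → ℂ))) : Type _ :=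
  MvPolynomial ι ℂ ⧸ MvPolynomial.vanishingIdeal ℂ (affineCone X)

/-- The dimension of a projective variety `X`: the dimension of the affine cone over `X`, computed
as the transcendence degree of its coordinate ring over `ℂ`, minus one. (For `X` irreducible this
is the transcendence degree of the function field of `X`; for `X = ∅` it is `-1`.) -/
def projDim (X : Set (ℙ ℂ (ι → ℂ))) : ℤ :=
  (Cardinal.toNat (Algebra.trdeg ℂ (CoordRing X)) : ℤ) - 1

/-- `X` is nondegenerate: it is not contained in a hyperplane. -/
def Nondegenerate (X : Set (ℙ ℂ (ι → ℂ))) : Prop :=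
  ∀ φ : (ι → ℂ) →ₗ[ℂ] ℂ, φ ≠ 0 → ∃ p ∈ X, φ p.rep ≠ 0

end Zariski

section Secant

variable {ι : Type*}

/-- The `h`-secant variety of `X`: the Zariski closure of the set of the points that lie in the span
of `h + 1` independent points of `X`. -/
def secantVariety (h : ℕ) (X : Set (ℙ ℂ (ι → ℂ))) : Set (ℙ ℂ (ι → ℂ)) :=
  closure {p | ∃ q : Fin (h + 1) → ℙ ℂ (ι → ℂ), (∀ j, q j ∈ X) ∧
    Projectivization.Independent q ∧ p.submodule ≤ ⨆ j, (q j).submodule}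

variable [Fintype ι]

/-- `min {(n + 1)(h + 1) - 1, r}`, where `n = dim X` and `r = card ι - 1` is the dimension of the
ambient projective space. -/
def expectedSecantDim (h : ℕ) (X : Set (ℙ ℂ (ι → ℂ))) : ℤ :=
  min ((projDim X + 1) * (h + 1) - 1) ((Fintype.card ι : ℤ) - 1)

/-- `X` is `h`-defective. -/
def IsDefective (h : ℕ) (X : Set (ℙ ℂ (ι → ℂ))) : Prop :=
  projDim (secantVariety h X) < expectedSecantDim h X

/-- The `h`-defect of `X`. -/
def secantDefect (h : ℕ) (X : Set (ℙ ℂ (ι → ℂ))) : ℤ :=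
  expectedSecantDim h X - projDim (secantVariety h X)

end Secant

section Grassmannian

/-- The Grassmannian `G(k, r)` of the `k`-dimensional linear subspaces of `P^r`, that is, of the
`(k + 1)`-dimensional vector subspaces of `ℂ^(r + 1)`. -/
def Grass (k r : ℕ) : Type :=
  {W : Submodule ℂ (Fin (r + 1) → ℂ) // Module.finrank ℂ W = k + 1}

/-- The maximal minors of an `m × n` matrix, indexed by the increasing sequences of `m` columns. -/
def maximalMinors {m n : ℕ} (B : Matrix (Fin m) (Fin n) ℂ) : (Fin m ↪o Fin n) → ℂ :=
  fun s => (B.submatrix id s).det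

theorem maximalMinors_ne_zero {m n : ℕ} (B : Matrix (Fin m) (Fin n) ℂ)
    (hB : LinearIndependent ℂ B.row) : maximalMinors B ≠ 0 := by
  classical
  have hrank : B.rank = m := by simpa using hB.rank_matrix
  obtain ⟨κ, a, ha, hspan, hli⟩ := exists_linearIndependent' ℂ B.col
  have : Finite κ := Finite.of_injective a ha
  have : Fintype κ := Fintype.ofFinite κ
  have hcard : Fintype.card κ = m := by
    rw [← finrank_span_eq_card hli, hspan, ← Matrix.rank_eq_finrank_span_cols, hrank]
  let s : Finset (Fin n) := Finset.univ.image a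
  have hs : s.card = m := by
    rw [Finset.card_image_of_injective _ ha, Finset.card_univ, hcard]
  let f : Fin m ↪o Fin n := s.orderEmbOfFin hs
  have hf : ∀ i, ∃ x, a x = f i := fun i => by
    obtain ⟨x, -, hx⟩ := Finset.mem_image.1 (s.orderEmbOfFin_mem hs i)
    exact ⟨x, hx⟩
  choose e he using hf
  have he' : Function.Injective e := fun i j hij => f.injective (by rw [← he, ← he, hij])
  have hli' : LinearIndependent ℂ (B.submatrix id f).col := by
    have h1 := hli.comp e he'
    have h2 : (B.col ∘ a) ∘ e = (B.submatrix id f).col := by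
      ext i j
      change B j (a (e i)) = B j (f i)
      rw [he]
    rwa [h2] at h1
  intro h0
  have hdet : (B.submatrix id f).det = 0 := congrFun h0 f
  have hu := Matrix.linearIndependent_cols_iff_isUnit.1 hli'
  rw [Matrix.isUnit_iff_isUnit_det, hdet] at hu
  exact not_isUnit_zero hu

/-- The matrix whose rows are a basis of the subspace `W`. -/
def basisMatrix {k r : ℕ} (W : Grass k r) : Matrix (Fin (k + 1)) (Fin (r + 1)) ℂ :=
  fun i => (Module.finBasisOfFinrankEq ℂ W.1 W.2 i : Fin (r + 1) → ℂ)

theorem basisMatrix_linearIndependent {k r : ℕ} (W : Grass k r) :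
    LinearIndependent ℂ (basisMatrix W).row :=
  (Module.finBasisOfFinrankEq ℂ W.1 W.2).linearIndependent.map' W.1.subtype (Submodule.ker_subtype _)

/-- The Plücker embedding: a subspace is sent to the point whose homogeneous coordinates are the
maximal minors of a matrix whose rows form a basis of the subspace. (Another basis multiplies all
the minors by the same nonzero scalar.) -/
def plucker {k r : ℕ} (W : Grass k r) : ℙ ℂ ((Fin (k + 1) ↪o Fin (r + 1)) → ℂ) :=
  Projectivization.mk ℂ (maximalMinors (basisMatrix W))
    (maximalMinors_ne_zero _ (basisMatrix_linearIndependent W))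

/-- The Zariski topology of the Grassmannian, as a subspace of projective space. -/
instance grassTopology (k r : ℕ) : TopologicalSpace (Grass k r) :=
  TopologicalSpace.induced plucker inferInstance

/-- The `(k, h)`-Grassmann secant variety of `V ⊆ P^r`: the Zariski closure in `G(k, r)` of the set
of the `k`-dimensional linear subspaces that lie in the span of `h + 1` independent points of `V`. -/
def grassSecantVariety (k h : ℕ) {r : ℕ} (V : Set (ℙ ℂ (Fin (r + 1) → ℂ))) : Set (Grass k r) :=
  closure {W | ∃ q : Fin (h + 1) → ℙ ℂ (Fin (r + 1) → ℂ), (∀ j, q j ∈ V) ∧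
    Projectivization.Independent q ∧ W.1 ≤ ⨆ j, (q j).submodule}

/-- The dimension of a closed subset of the Grassmannian, as a projective variety in its Plücker
embedding. -/
def grassDim {k r : ℕ} (Y : Set (Grass k r)) : ℤ :=
  projDim (plucker '' Y)

/-- `min {(h + 1) n + (k + 1)(h - k), (k + 1)(r - k)}`, where `n = dim V`. -/
def expectedGrassSecantDim (k h : ℕ) {r : ℕ} (V : Set (ℙ ℂ (Fin (r + 1) → ℂ))) : ℤ :=
  min ((h + 1) * projDim V + (k + 1) * (h - k)) ((k + 1) * (r - k))

/-- `V` is `(k, h)`-Grassmann defective. -/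
def IsGrassDefective (k h : ℕ) {r : ℕ} (V : Set (ℙ ℂ (Fin (r + 1) → ℂ))) : Prop :=
  grassDim (grassSecantVariety k h V) < expectedGrassSecantDim k h V

/-- The `(k, h)`-defect of `V`. -/
def grassDefect (k h : ℕ) {r : ℕ} (V : Set (ℙ ℂ (Fin (r + 1) → ℂ))) : ℤ :=
  expectedGrassSecantDim k h V - grassDim (grassSecantVariety k h V)

end Grassmannian

section Segre

theorem segre_ne_zero {k r : ℕ} (a : ℙ ℂ (Fin (k + 1) → ℂ)) (p : ℙ ℂ (Fin (r + 1) → ℂ)) :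
    (fun x : Fin (k + 1) × Fin (r + 1) => a.rep x.1 * p.rep x.2) ≠ 0 := by
  obtain ⟨i, hi⟩ := Function.ne_iff.1 a.rep_nonzero
  obtain ⟨j, hj⟩ := Function.ne_iff.1 p.rep_nonzero
  exact Function.ne_iff.2 ⟨(i, j), mul_ne_zero hi hj⟩

/-- The Segre embedding `σ : P^k × P^r → P^(r(k+1)+k)`, `(a, p) ↦ (a_α p_β)`, where the homogeneous
coordinates of the target are indexed by the `(k + 1)(r + 1)` pairs `(α, β)`. -/
def segre {k r : ℕ} (x : ℙ ℂ (Fin (k + 1) → ℂ) × ℙ ℂ (Fin (r + 1) → ℂ)) :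
    ℙ ℂ (Fin (k + 1) × Fin (r + 1) → ℂ) :=
  Projectivization.mk ℂ (fun y => x.1.rep y.1 * x.2.rep y.2) (segre_ne_zero x.1 x.2)

/-- The Segre image `σ(P^k × V)`. -/
def segreImage (k : ℕ) {r : ℕ} (V : Set (ℙ ℂ (Fin (r + 1) → ℂ))) :
    Set (ℙ ℂ (Fin (k + 1) × Fin (r + 1) → ℂ)) :=
  segre '' (Set.univ ×ˢ V)

end Segre

end GrassmannDefect

end

/-!
A point of `P^(r(k+1)+k)` is a matrix `A` with `k + 1` rows in `ℂ^(r+1)`, up to a scalar, and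
`σ(P^k × V)` consists of the matrices `l ⊗ v` of rank one with `v` in the affine cone `C` over `V`.
A sum `∑ j, l j ⊗ v j` of `h + 1` of them is a matrix whose rows lie in the span of
`v 0, …, v h`. Hence a matrix of rank `k + 1` in the cone `Z` of these sums has as its row space a
point of the Grassmann secant variety, and conversely all the matrices with a given such row space lie
in `Z`. The fibres of `A ↦ (row space of A)` are torsors under `GL_(k+1)`, so
`dim Sec_h(σ(P^k × V)) = dim Sec_{k,h}(V) + (k + 1)² - 1`. As `dim σ(P^k × V) = dim V + k`, the
expected dimensions differ by the same number, and the two defects agree.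

Dimensions are transcendence degrees. If a set has a prime vanishing ideal, it has a generic point
with coordinates in a field (`exists_isGenericPoint`), and its dimension is the transcendence degree of
the algebra generated by these coordinates. Let `A` be the generic matrix of `Z` over the field `L`,
and let `B` be an invertible block of `A`. Because `Z` is stable under left multiplication, `Y * A`
with independent variables `Y` over `L` is again a generic point, and after a change of variables so is
`Y * M` with `M = B⁻¹ * A`. As `M` has an identity block, the entries of `Y * M` generate the field of
`Y` and `M`, while its maximal minors generate the field of `det Y` and `M` by Cramer's rule. This
gives the difference `(k + 1)² - 1` (`coneTrdeg_minors`); the dimension of the Segre image is found in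
the same way (`coneTrdeg_tensorCone`).

It remains to see that `Z` and its set of minors have the same vanishing ideals as the cones over the two
secant varieties, although these are closures of sets of points in general position
(`vanishingIdeal_secantVariety`, `vanishingIdeal_grassSecantVariety`). General position is a
nonempty open condition on the parameters `(l, v)`, and the parameter space is irreducible because
powers of `C` are (`vanishingIdeal_pow_isPrime`). The condition is nonempty since `V` spans `P^r` and
`h ≤ r`.
-/

noncomputable section

namespace GrassmannDefect

/-! ### Transcendence degree of generated subalgebras -/

section TranscendenceDegree

variable {F : Type} [Field F]

/-- The transcendence degree over `F` of the subalgebra generated by `S`, as a natural number. -/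
def adjoinTrdeg (F : Type) [Field F] {A : Type} [CommRing A] [Algebra F A] (S : Set A) : ℕ :=
  Cardinal.toNat (Algebra.trdeg F (Algebra.adjoin F S))

open scoped IntermediateField.algebraAdjoinAdjoin in
/-- Passing to the field of fractions does not change the transcendence degree, so it may be computed
after inverting elements. -/
theorem adjoinTrdeg_eq_intermediateField {K : Type} [Field K] [Algebra F K] (S : Set K) :
    adjoinTrdeg F S = Cardinal.toNat (Algebra.trdeg F (IntermediateField.adjoin F S)) := by
  unfold adjoinTrdeg
  have : Algebra.IsAlgebraic (Algebra.adjoin F S) (IntermediateField.adjoin F S) :=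
    IsLocalization.isAlgebraic _ (nonZeroDivisors (Algebra.adjoin F S))
  rw [← trdeg_add_eq F (Algebra.adjoin F S) (A := IntermediateField.adjoin F S),
    trdeg_eq_zero (R := Algebra.adjoin F S), add_zero]

theorem adjoinTrdeg_congr {K : Type} [Field K] [Algebra F K] {S T : Set K}
    (hST : S ⊆ IntermediateField.adjoin F T) (hTS : T ⊆ IntermediateField.adjoin F S) :
    adjoinTrdeg F S = adjoinTrdeg F T := by
  rw [adjoinTrdeg_eq_intermediateField, adjoinTrdeg_eq_intermediateField,
    le_antisymm (IntermediateField.adjoin_le_iff.2 hST) (IntermediateField.adjoin_le_iff.2 hTS)]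

/-- Adjoining a family that is algebraically independent over a field containing `S` raises the
transcendence degree by the size of the family. -/
theorem adjoinTrdeg_range_union {L K : Type} [Field L] [Field K] [Algebra F L] [Algebra F K]
    [Algebra L K] [IsScalarTower F L K] {σ : Type} [Fintype σ] {u : σ → K}
    (hu : AlgebraicIndependent L u) {S : Set L} (hS : S.Finite) :
    adjoinTrdeg F (Set.range u ∪ algebraMap L K '' S) = Fintype.card σ + adjoinTrdeg F S := by
  have hu' : AlgebraicIndependent (Algebra.adjoin F S) u :=
    hu.restrictScalars (Subtype.val_injective (p := (· ∈ Algebra.adjoin F S)))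
  let φ : MvPolynomial σ (Algebra.adjoin F S) →ₐ[F] K :=
    (MvPolynomial.aeval (R := Algebra.adjoin F S) u).restrictScalars F
  have hφ : Function.Injective φ := hu'
  have hr : φ.range = Algebra.adjoin F (Set.range u ∪ algebraMap L K '' S) := by
    apply le_antisymm
    · rintro _ ⟨p, rfl⟩
      induction p using MvPolynomial.induction_on with
      | C a =>
        have h1 : φ.toRingHom (MvPolynomial.C a) = algebraMap L K a := by
          change MvPolynomial.aeval u (MvPolynomial.C a) = _
          rw [MvPolynomial.aeval_C]; rfl
        rw [h1]
        have h2 : (Algebra.adjoin F S).map (IsScalarTower.toAlgHom F L K) ≤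
            Algebra.adjoin F (Set.range u ∪ algebraMap L K '' S) := by
          rw [AlgHom.map_adjoin]
          exact Algebra.adjoin_mono Set.subset_union_right
        exact h2 ⟨a, a.2, rfl⟩
      | add p q hp hq => rw [map_add]; exact add_mem hp hq
      | mul_X p i hp =>
        rw [map_mul]
        refine mul_mem hp (Algebra.subset_adjoin (Or.inl ⟨i, ?_⟩))
        exact (MvPolynomial.aeval_X _ _).symm
    · rw [Algebra.adjoin_le_iff]
      rintro _ (⟨i, rfl⟩ | ⟨s, hs, rfl⟩)
      · exact ⟨MvPolynomial.X i, MvPolynomial.aeval_X _ _⟩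
      · exact ⟨MvPolynomial.C ⟨s, Algebra.subset_adjoin hs⟩, MvPolynomial.aeval_C _ _⟩
  have hfin : Algebra.FiniteType F (Algebra.adjoin F S) :=
    (Subalgebra.fg_iff_finiteType _).1 ⟨hS.toFinset, by simp⟩
  unfold adjoinTrdeg
  rw [← hr, ← (AlgEquiv.ofInjective φ hφ).trdeg_eq,
    ← trdeg_add_eq F (Algebra.adjoin F S) (A := MvPolynomial σ (Algebra.adjoin F S)),
    MvPolynomial.trdeg_of_isDomain, Cardinal.toNat_add (trdeg_lt_aleph0_of_finiteType)
      (by simp)]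
  simp [add_comm]

end TranscendenceDegree

/-! ### Products of a generic matrix with a normalized matrix -/

section GenericMatrix

/-- The minor on an arbitrary sequence of columns is, up to sign, a maximal minor or zero. -/
theorem det_submatrix_mem {K : Type*} [Field K] {m n : ℕ} (A : Matrix (Fin m) (Fin n) K)
    (E : Subfield K) (hE : ∀ s : Fin m ↪o Fin n, (A.submatrix id s).det ∈ E)
    (c : Fin m → Fin n) : (A.submatrix id c).det ∈ E := by
  by_cases hc : Function.Injective c
  · let s : Finset (Fin n) := Finset.univ.image c
    have hs : s.card = m := by
      rw [Finset.card_image_of_injective _ hc, Finset.card_univ, Fintype.card_fin]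
    let f : Fin m ↪o Fin n := s.orderEmbOfFin hs
    have hf : ∀ i, ∃ x, f x = c i := fun i => by
      have : c i ∈ Set.range f := by
        rw [Finset.range_orderEmbOfFin]
        exact Finset.mem_coe.2 (Finset.mem_image_of_mem _ (Finset.mem_univ _))
      exact this
    choose e he using hf
    have he' : Function.Injective e := fun i j hij => hc (by rw [← he, ← he, hij])
    let e' : Equiv.Perm (Fin m) := Equiv.ofBijective e (Finite.injective_iff_bijective.1 he')
    have h1 : A.submatrix id c = (A.submatrix id f).submatrix id e' := by
      ext i j
      exact congrArg (A i) (he j).symm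
    rw [h1, Matrix.det_permute']
    exact mul_mem (intCast_mem E _) (hE f)
  · obtain ⟨i, j, hij, hne⟩ := Function.not_injective_iff.1 hc
    rw [Matrix.det_zero_of_column_eq hne (fun l => by simp [hij])]
    exact zero_mem E

variable {F L K : Type} [Field F] [Field L] [Field K] [Algebra F L] [Algebra F K]
  [Algebra L K] [IsScalarTower F L K]

/-- If the entries of `U` are independent variables and `M` has an identity block, then `U` is a block
of `U * M`, and the entries of `U * M` generate the same field as those of `U` and `M` together. -/
theorem adjoinTrdeg_generic_mul {m n : ℕ} {U : Matrix (Fin m) (Fin m) K}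
    (hU : AlgebraicIndependent L (fun x : Fin m × Fin m => U x.1 x.2)) (hdet : U.det ≠ 0)
    (M : Matrix (Fin m) (Fin n) L) (s₀ : Fin m ↪o Fin n) (hM : M.submatrix id s₀ = 1) :
    adjoinTrdeg F (Set.range fun x : Fin m × Fin n => (U * M.map (algebraMap L K)) x.1 x.2) =
      m * m + adjoinTrdeg F (Set.range fun x : Fin m × Fin n => M x.1 x.2) := by
  set N := M.map (algebraMap L K) with hN
  have hN0 : N.submatrix id s₀ = 1 := by
    rw [hN, Matrix.submatrix_map, hM]; simp
  have key := adjoinTrdeg_range_union (F := F) hU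
    (Set.finite_range fun x : Fin m × Fin n => M x.1 x.2)
  rw [Fintype.card_prod, Fintype.card_fin] at key
  rw [← key]
  apply adjoinTrdeg_congr
  · rintro _ ⟨⟨i, j⟩, rfl⟩
    simp only [SetLike.mem_coe]
    simp only [Matrix.mul_apply]
    refine sum_mem fun l _ => mul_mem ?_ ?_
    · exact IntermediateField.subset_adjoin _ _ (Or.inl ⟨(i, l), rfl⟩)
    · exact IntermediateField.subset_adjoin _ _ (Or.inr ⟨_, ⟨(l, j), rfl⟩, rfl⟩)
  · set E := IntermediateField.adjoin F
      (Set.range fun x : Fin m × Fin n => (U * N) x.1 x.2) with hE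
    have hUN : ∀ i j, (U * N) i j ∈ E := fun i j =>
      IntermediateField.subset_adjoin _ _ ⟨(i, j), rfl⟩
    have hU' : U = (U * N).submatrix id s₀ := by
      rw [Matrix.submatrix_mul U N id id s₀ Function.bijective_id, hN0, mul_one]; rfl
    have hUE : ∀ i j, U i j ∈ E := fun i j => by
      rw [hU']; exact hUN _ _
    rintro _ (⟨⟨i, j⟩, rfl⟩ | ⟨_, ⟨⟨i, j⟩, rfl⟩, rfl⟩)
    · exact hUE i j
    · have hcr : U.det • N = U.adjugate * (U * N) := by
        rw [← Matrix.mul_assoc, Matrix.adjugate_mul, Matrix.smul_mul, Matrix.one_mul]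
      have h2 : algebraMap L K (M i j) = U.det⁻¹ * (U.adjugate * (U * N)) i j := by
        rw [← hcr, Matrix.smul_apply, smul_eq_mul, inv_mul_cancel_left₀ hdet]; rfl
      have hdetE : ∀ B : Matrix (Fin m) (Fin m) K, (∀ i j, B i j ∈ E) → B.det ∈ E := by
        intro B hB
        rw [Matrix.det_apply']
        exact sum_mem fun σ _ => mul_mem (intCast_mem E _) (prod_mem fun i _ => hB _ _)
      change algebraMap L K (M i j) ∈ E
      rw [h2, Matrix.mul_apply]
      refine mul_mem (inv_mem (hdetE _ hUE)) (sum_mem fun l _ => mul_mem ?_ (hUN _ _))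
      rw [Matrix.adjugate_apply]
      refine hdetE _ fun a b => ?_
      by_cases hab : a = l
      · subst hab
        rw [Matrix.updateRow_self, Pi.single_apply]
        split_ifs
        exacts [one_mem E, zero_mem E]
      · rw [Matrix.updateRow_ne hab]; exact hUE _ _

/-- By Cramer's rule, the ratios of the maximal minors of `U * M` generate the same field as the
entries of `M`, so the minors themselves add only the determinant of `U`. -/
theorem adjoinTrdeg_generic_minors {m n : ℕ} {U : Matrix (Fin m) (Fin m) K}
    (hU : Transcendental L U.det)
    (M : Matrix (Fin m) (Fin n) L) (s₀ : Fin m ↪o Fin n) (hM : M.submatrix id s₀ = 1) :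
    adjoinTrdeg F (Set.range fun s : Fin m ↪o Fin n =>
      ((U * M.map (algebraMap L K)).submatrix id s).det) =
      1 + adjoinTrdeg F (Set.range fun x : Fin m × Fin n => M x.1 x.2) := by
  have hdet : U.det ≠ 0 := fun h => hU (h ▸ isAlgebraic_zero)
  set N := M.map (algebraMap L K) with hN
  have hN0 : N.submatrix id s₀ = 1 := by
    rw [hN, Matrix.submatrix_map, hM]; simp
  have hind : AlgebraicIndependent L (fun _ : Unit => U.det) :=
    (algebraicIndependent_unique_type_iff (ι := Unit)).2 hU
  have key := adjoinTrdeg_range_union (F := F) hind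
    (Set.finite_range fun x : Fin m × Fin n => M x.1 x.2)
  rw [Fintype.card_unit] at key
  have hmul : ∀ c : Fin m → Fin n, (U * N).submatrix id c = U * N.submatrix id c := fun c => by
    rw [Matrix.submatrix_mul U N id id c Function.bijective_id]; rfl
  rw [← key]
  apply adjoinTrdeg_congr
  · rintro _ ⟨s, rfl⟩
    simp only [hmul, Matrix.det_mul, SetLike.mem_coe]
    refine mul_mem (IntermediateField.subset_adjoin _ _ (Or.inl ⟨(), rfl⟩)) ?_
    rw [Matrix.det_apply' (N.submatrix id s)]
    have hN' : ∀ i j, N i j ∈ IntermediateField.adjoin F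
        (Set.range (fun _ : Unit => U.det) ∪
          algebraMap L K '' Set.range fun x : Fin m × Fin n => M x.1 x.2) := fun i j =>
      IntermediateField.subset_adjoin _ _ (Or.inr ⟨_, ⟨(i, j), rfl⟩, rfl⟩)
    exact sum_mem fun σ _ => mul_mem (intCast_mem _ _) (prod_mem fun i _ => hN' _ _)
  · set E := IntermediateField.adjoin F
      (Set.range fun s : Fin m ↪o Fin n => ((U * N).submatrix id s).det) with hE
    have hmin : ∀ c : Fin m → Fin n, ((U * N).submatrix id c).det ∈ E :=
      det_submatrix_mem _ E.toSubfield fun s =>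
        IntermediateField.subset_adjoin _ _ ⟨s, rfl⟩
    have hUE : U.det ∈ E := by
      have := hmin s₀
      rwa [hmul, hN0, mul_one] at this
    rintro _ (⟨_, rfl⟩ | ⟨_, ⟨⟨i, j⟩, rfl⟩, rfl⟩)
    · exact hUE
    -- the entry `(i, j)` is the minor of `M` obtained from the identity block by replacing its
    -- `i`-th column with the `j`-th column of `M`
    · have h1 := hmin (Function.update s₀ i j)
      have h2 : N.submatrix id (Function.update s₀ i j) =
          (1 : Matrix (Fin m) (Fin m) K).updateCol i (fun l => N l j) := by
        ext a b
        by_cases hb : b = i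
        · subst hb; simp
        · rw [Matrix.updateCol_ne hb, ← hN0]; simp [hb]
      have h3 : ((1 : Matrix (Fin m) (Fin m) K).updateCol i (fun l => N l j)).det = N i j := by
        rw [← Matrix.cramer_apply, Matrix.cramer_one]; rfl
      rw [hmul, h2, Matrix.det_mul, h3] at h1
      have h4 := mul_mem (inv_mem hUE) h1
      rwa [inv_mul_cancel_left₀ hdet] at h4

/-- The analogue of `adjoinTrdeg_generic_mul` for the products `u i * x j`, where some `x b` is `1`. -/
theorem adjoinTrdeg_generic_tensor {κ ι : Type} [Fintype κ] [Nonempty κ] [Finite ι] {u : κ → K}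
    (hu : AlgebraicIndependent L u) (x : ι → L) (b : ι) (hb : x b = 1) :
    adjoinTrdeg F (Set.range fun y : κ × ι => u y.1 * algebraMap L K (x y.2)) =
      Fintype.card κ + adjoinTrdeg F (Set.range x) := by
  rw [← adjoinTrdeg_range_union (F := F) hu (Set.finite_range x)]
  apply adjoinTrdeg_congr
  · rintro _ ⟨⟨i, j⟩, rfl⟩
    exact mul_mem (IntermediateField.subset_adjoin _ _ (Or.inl ⟨i, rfl⟩))
      (IntermediateField.subset_adjoin _ _ (Or.inr ⟨_, ⟨j, rfl⟩, rfl⟩))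
  · have hm : ∀ i j, u i * algebraMap L K (x j) ∈ IntermediateField.adjoin F
        (Set.range fun y : κ × ι => u y.1 * algebraMap L K (x y.2)) := fun i j =>
      IntermediateField.subset_adjoin _ _ ⟨(i, j), rfl⟩
    have hui : ∀ i, u i ∈ IntermediateField.adjoin F
        (Set.range fun y : κ × ι => u y.1 * algebraMap L K (x y.2)) := fun i => by
      simpa [hb] using hm i b
    rintro _ (⟨i, rfl⟩ | ⟨_, ⟨j, rfl⟩, rfl⟩)
    · exact hui i
    · let i : κ := Classical.arbitrary κ
      have := mul_mem (inv_mem (hui i)) (hm i j)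
      rwa [inv_mul_cancel_left₀ (hu.ne_zero i)] at this

end GenericMatrix

/-! ### Generic points of sets in affine space -/

section GenericPoint

variable {ι κ σ : Type}

/-- The dimension of the Zariski closure of a set `Z` in affine space, as the transcendence degree of
the ring of polynomial functions on `Z`. -/
def coneTrdeg (Z : Set (ι → ℂ)) : ℕ :=
  Cardinal.toNat (Algebra.trdeg ℂ (MvPolynomial ι ℂ ⧸ MvPolynomial.vanishingIdeal ℂ Z))

/-- A tuple `x` in a `ℂ`-algebra is a generic point of the set `Z` if the polynomials that vanish
at `x` are exactly those that vanish on `Z`. -/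
def IsGenericPoint (Z : Set (ι → ℂ)) {A : Type} [CommRing A] [Algebra ℂ A] (x : ι → A) : Prop :=
  ∀ f : MvPolynomial ι ℂ, MvPolynomial.aeval x f = 0 ↔ ∀ a ∈ Z, MvPolynomial.aeval a f = 0

variable {A B : Type} [CommRing A] [Algebra ℂ A] [CommRing B] [Algebra ℂ B]

theorem IsGenericPoint.coneTrdeg_eq {Z : Set (ι → ℂ)} {x : ι → A} (hx : IsGenericPoint Z x) :
    coneTrdeg Z = adjoinTrdeg ℂ (Set.range x) := by
  have hker : MvPolynomial.vanishingIdeal ℂ Z = RingHom.ker (MvPolynomial.aeval (R := ℂ) x) := by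
    ext f
    rw [MvPolynomial.mem_vanishingIdeal_iff, RingHom.mem_ker]
    exact (hx f).symm
  unfold coneTrdeg adjoinTrdeg
  rw [Algebra.adjoin_range_eq_range_aeval, hker]
  exact congrArg _ (Ideal.quotientKerEquivRange (MvPolynomial.aeval (R := ℂ) x)).trdeg_eq

theorem IsGenericPoint.map {Z : Set (ι → ℂ)} {x : ι → A} (hx : IsGenericPoint Z x)
    (φ : A →ₐ[ℂ] B) (hφ : Function.Injective φ) : IsGenericPoint Z (fun i => φ (x i)) := fun f => by
  rw [← hx f, ← map_eq_zero_iff φ hφ, ← MvPolynomial.comp_aeval_apply]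

theorem IsGenericPoint.isPrime [IsDomain A] {Z : Set (ι → ℂ)} {x : ι → A}
    (hx : IsGenericPoint Z x) : (MvPolynomial.vanishingIdeal ℂ Z).IsPrime := by
  have hker : MvPolynomial.vanishingIdeal ℂ Z = RingHom.ker (MvPolynomial.aeval (R := ℂ) x) := by
    ext f
    rw [MvPolynomial.mem_vanishingIdeal_iff, RingHom.mem_ker]
    exact (hx f).symm
  rw [hker]
  exact RingHom.ker_isPrime _

/-- An irreducible set has a generic point with coordinates in a field, namely the coordinate functions
in its function field. -/
theorem exists_isGenericPoint {Z : Set (ι → ℂ)} (hZ : (MvPolynomial.vanishingIdeal ℂ Z).IsPrime) :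
    ∃ (L : Type) (_ : Field L) (_ : Algebra ℂ L) (x : ι → L), IsGenericPoint Z x := by
  let R := MvPolynomial ι ℂ ⧸ MvPolynomial.vanishingIdeal ℂ Z
  let q : MvPolynomial ι ℂ →ₐ[ℂ] FractionRing R :=
    (IsScalarTower.toAlgHom ℂ R (FractionRing R)).comp (Ideal.Quotient.mkₐ ℂ _)
  refine ⟨FractionRing R, inferInstance, inferInstance, fun i => q (MvPolynomial.X i), fun f => ?_⟩
  have h1 : MvPolynomial.aeval (fun i => q (MvPolynomial.X i)) f = q f := by
    rw [← MvPolynomial.comp_aeval_apply, MvPolynomial.aeval_X_left_apply]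
  rw [h1]
  change algebraMap R (FractionRing R) (Ideal.Quotient.mk _ f) = 0 ↔ _
  rw [map_eq_zero_iff _ (IsFractionRing.injective R (FractionRing R)), Ideal.Quotient.eq_zero_iff_mem,
    MvPolynomial.mem_vanishingIdeal_iff]

/-- Adding free coordinates `y` to a set adds independent variables to its generic point. -/
theorem IsGenericPoint.prod_univ {Z : Set (ι → ℂ)} {x : ι → A} (hx : IsGenericPoint Z x) :
    IsGenericPoint {w : σ ⊕ ι → ℂ | w ∘ Sum.inr ∈ Z}
      (Sum.elim MvPolynomial.X fun i => MvPolynomial.C (x i) : σ ⊕ ι → MvPolynomial σ A) := by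
  intro P
  set P' := MvPolynomial.sumAlgEquiv ℂ σ ι P with hP'
  have h1 : MvPolynomial.aeval
      (Sum.elim MvPolynomial.X fun i => MvPolynomial.C (x i) : σ ⊕ ι → MvPolynomial σ A) P =
      MvPolynomial.mapAlgHom (MvPolynomial.aeval (R := ℂ) x) P' := by
    rw [hP', ← AlgEquiv.coe_toAlgHom, ← AlgHom.comp_apply]
    congr 1
    ext i : 1
    rcases i with i | i <;> simp [MvPolynomial.sumAlgEquiv_X_inl, MvPolynomial.sumAlgEquiv_X_inr]
  have h2 : ∀ w : σ ⊕ ι → ℂ, MvPolynomial.aeval w P =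
      MvPolynomial.aeval (w ∘ Sum.inl)
        (MvPolynomial.mapAlgHom (MvPolynomial.aeval (R := ℂ) (w ∘ Sum.inr)) P') := by
    intro w
    rw [hP', ← AlgEquiv.coe_toAlgHom, ← AlgHom.comp_apply, ← AlgHom.comp_apply]
    congr 1
    ext i : 1
    rcases i with i | i <;> simp [MvPolynomial.sumAlgEquiv_X_inl, MvPolynomial.sumAlgEquiv_X_inr]
  rw [h1]
  constructor
  · intro h w hw
    have h3 : MvPolynomial.mapAlgHom (σ := σ) (MvPolynomial.aeval (R := ℂ) (w ∘ Sum.inr)) P' = 0 := by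
      ext m
      have := congrArg (MvPolynomial.coeff m) h
      rw [MvPolynomial.mapAlgHom_apply, MvPolynomial.coeff_map, MvPolynomial.coeff_zero] at this ⊢
      exact (hx _).1 this _ hw
    rw [h2, h3, map_zero]
  · intro h
    ext m
    rw [MvPolynomial.mapAlgHom_apply, MvPolynomial.coeff_map, MvPolynomial.coeff_zero]
    refine (hx _).2 fun a ha => ?_
    have h3 : MvPolynomial.mapAlgHom (σ := σ) (MvPolynomial.aeval (R := ℂ) a) P' = 0 := by
      apply MvPolynomial.funext
      intro y
      have := h (Sum.elim y a) (by simpa using ha)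
      rw [h2] at this
      simpa using this
    have := congrArg (MvPolynomial.coeff m) h3
    rwa [MvPolynomial.mapAlgHom_apply, MvPolynomial.coeff_map, MvPolynomial.coeff_zero] at this

/-- A polynomial map sends a generic point of a set to a generic point of the image. -/
theorem IsGenericPoint.image {Z : Set (ι → ℂ)} {x : ι → A} (hx : IsGenericPoint Z x)
    (Ψ : κ → MvPolynomial ι ℂ) :
    IsGenericPoint ((fun a i => MvPolynomial.aeval a (Ψ i)) '' Z)
      (fun i => MvPolynomial.aeval x (Ψ i)) := by
  intro f
  simp only [Set.forall_mem_image, ← MvPolynomial.comp_aeval_apply]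
  exact hx _

end GenericPoint

/-! ### Linear changes of independent variables -/

section ChangeOfVariables

variable {L K : Type} [Field L] [Field K] [Algebra L K] {σ : Type}

/-- An injective substitution of variables, here one with a left inverse `q`, preserves algebraic
independence. -/
theorem algebraicIndependent_aeval {u : σ → K} (hu : AlgebraicIndependent L u)
    (p q : σ → MvPolynomial σ L) (hpq : ∀ i, MvPolynomial.aeval q (p i) = MvPolynomial.X i) :
    AlgebraicIndependent L (fun i => MvPolynomial.aeval u (p i)) := by
  have h1 : Function.LeftInverse (MvPolynomial.aeval (R := L) q) (MvPolynomial.aeval (R := L) p) := by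
    intro f
    rw [MvPolynomial.comp_aeval_apply]
    simp only [hpq, MvPolynomial.aeval_X_left_apply]
  have h2 : (MvPolynomial.aeval (R := L) fun i => MvPolynomial.aeval u (p i)) =
      (MvPolynomial.aeval u).comp (MvPolynomial.aeval p) := by
    ext i; simp
  unfold AlgebraicIndependent
  rw [h2, AlgHom.coe_comp]
  exact Function.Injective.comp hu h1.injective

theorem algebraicIndependent_mul_const {u : σ → K} (hu : AlgebraicIndependent L u) {c : L}
    (hc : c ≠ 0) : AlgebraicIndependent L (fun i => u i * algebraMap L K c) := by
  have := algebraicIndependent_aeval hu (fun i => MvPolynomial.X i * MvPolynomial.C c)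
    (fun i => MvPolynomial.X i * MvPolynomial.C c⁻¹) (fun i => by
      simp [mul_assoc, ← MvPolynomial.C_mul, hc])
  simpa using this

theorem algebraicIndependent_mul_matrix {m : ℕ} {U : Matrix (Fin m) (Fin m) K}
    (hU : AlgebraicIndependent L (fun x : Fin m × Fin m => U x.1 x.2))
    {P Q : Matrix (Fin m) (Fin m) L} (hQP : Q * P = 1) :
    AlgebraicIndependent L
      (fun x : Fin m × Fin m => (U * P.map (algebraMap L K)) x.1 x.2) := by
  have := algebraicIndependent_aeval hU
    (fun x => ∑ j, MvPolynomial.X (x.1, j) * MvPolynomial.C (P j x.2))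
    (fun x => ∑ j, MvPolynomial.X (x.1, j) * MvPolynomial.C (Q j x.2)) (fun x => by
      have h1 : ∀ l, ∑ j, Q l j * P j x.2 = if l = x.2 then 1 else 0 := fun l => by
        rw [← Matrix.mul_apply, hQP, Matrix.one_apply]
      simp only [map_sum, map_mul, MvPolynomial.aeval_X, MvPolynomial.aeval_C,
        MvPolynomial.algebraMap_eq, Finset.sum_mul]
      rw [Finset.sum_comm]
      simp only [mul_assoc, ← MvPolynomial.C_mul, ← Finset.mul_sum, ← map_sum, h1]
      simp [apply_ite])
  convert! this using 2 with x
  simp [Matrix.mul_apply]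

/-- The generic determinant specializes to a variable on the matrices `diag(t, 1, …, 1)`, so it is
transcendental. -/
theorem transcendental_det_mvPolynomialX (k : ℕ) :
    Transcendental L (Matrix.mvPolynomialX (Fin (k + 1)) (Fin (k + 1)) L).det := by
  intro h
  let f : MvPolynomial (Fin (k + 1) × Fin (k + 1)) L →ₐ[L] Polynomial L :=
    MvPolynomial.aeval fun x =>
      Matrix.diagonal (fun i : Fin (k + 1) => if i = 0 then (Polynomial.X : Polynomial L) else 1)
        x.1 x.2
  have h1 := h.algHom f
  have h2 : f (Matrix.mvPolynomialX (Fin (k + 1)) (Fin (k + 1)) L).det = Polynomial.X := by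
    rw [AlgHom.map_det]
    have : f.mapMatrix (Matrix.mvPolynomialX (Fin (k + 1)) (Fin (k + 1)) L) =
        Matrix.diagonal
          (fun i : Fin (k + 1) => if i = 0 then (Polynomial.X : Polynomial L) else 1) := by
      ext i j : 2
      simp [f]
    rw [this, Matrix.det_diagonal]
    simp
  rw [h2] at h1
  exact Polynomial.transcendental_X L h1

end ChangeOfVariables

/-! ### Dimensions of cones of matrices -/

section Dimension

/-- The tensors `l ⊗ v` with `v ∈ C`: the matrices of rank at most one whose row space is zero or
spanned by a vector of `C`. -/
def tensorCone (κ : Type) {ι : Type} (C : Set (ι → ℂ)) : Set (κ × ι → ℂ) :=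
  {w | ∃ l : κ → ℂ, ∃ v ∈ C, w = fun y => l y.1 * v y.2}

theorem tensorCone_eq_image (κ : Type) {ι : Type} (C : Set (ι → ℂ)) :
    tensorCone κ C = (fun (a : κ ⊕ ι → ℂ) (y : κ × ι) => MvPolynomial.aeval a
      (MvPolynomial.X (Sum.inl y.1) * MvPolynomial.X (Sum.inr y.2) : MvPolynomial (κ ⊕ ι) ℂ)) ''
        {w | w ∘ Sum.inr ∈ C} := by
  ext w
  constructor
  · rintro ⟨l, v, hv, rfl⟩
    exact ⟨Sum.elim l v, by simpa using hv, by ext; simp⟩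
  · rintro ⟨a, ha, rfl⟩
    exact ⟨a ∘ Sum.inl, _, ha, by ext; simp⟩

/-- The dimension of the cone of tensors `l ⊗ v`, `v ∈ C`: it exceeds the dimension of the cone `C`
by `card κ - 1`. -/
theorem coneTrdeg_tensorCone (κ : Type) {ι : Type} [Fintype κ] [Nonempty κ] [Finite ι]
    {C : Set (ι → ℂ)} (hC : (MvPolynomial.vanishingIdeal ℂ C).IsPrime)
    (hsmul : ∀ (c : ℂ), ∀ v ∈ C, c • v ∈ C) {v₀ : ι → ℂ} (hv₀ : v₀ ∈ C) {b : ι} (hb : v₀ b ≠ 0) :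
    coneTrdeg (tensorCone κ C) + 1 = coneTrdeg C + Fintype.card κ := by
  obtain ⟨L, _, _, x, hx⟩ := exists_isGenericPoint hC
  have hxb : x b ≠ 0 := fun h => by
    have := (hx (MvPolynomial.X b)).1 (by simpa using h) v₀ hv₀
    exact hb (by simpa using this)
  have hmain : ∀ (κ : Type) [Fintype κ] [Nonempty κ], coneTrdeg (tensorCone κ C) =
      Fintype.card κ + adjoinTrdeg ℂ (Set.range fun j => x j / x b) := by
    intro κ _ _
    let K := FractionRing (MvPolynomial κ L)
    have hinj : Function.Injective (algebraMap (MvPolynomial κ L) K) := IsFractionRing.injective _ _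
    let φ : MvPolynomial κ L →ₐ[ℂ] K := IsScalarTower.toAlgHom ℂ _ _
    let u : κ → K := fun i => algebraMap (MvPolynomial κ L) K (MvPolynomial.X i)
    have hu : AlgebraicIndependent L u :=
      (MvPolynomial.algebraicIndependent_X κ L).map' (f := IsScalarTower.toAlgHom L _ K) hinj
    have hg := ((hx.prod_univ (σ := κ)).image (fun y : κ × ι =>
      (MvPolynomial.X (Sum.inl y.1) * MvPolynomial.X (Sum.inr y.2)))).map φ hinj
    rw [← tensorCone_eq_image] at hg
    rw [hg.coneTrdeg_eq, ← adjoinTrdeg_generic_tensor (F := ℂ)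
      (algebraicIndependent_mul_const hu hxb) (fun j => x j / x b) b (div_self hxb)]
    congr 2
    ext y
    have h1 : ∀ a, φ (MvPolynomial.C a) = algebraMap L K a := fun a => rfl
    have h2 : algebraMap L K (x b) ≠ 0 := (map_ne_zero _).2 hxb
    simp only [map_mul, MvPolynomial.aeval_X, Sum.elim_inl, Sum.elim_inr, h1, map_div₀]
    rw [mul_assoc, mul_div_cancel₀ _ h2]
    rfl
  -- since `C` is stable under scaling, it is its own cone of tensors for a one-element index type
  have hunit : coneTrdeg C = coneTrdeg (tensorCone Unit C) := by
    have hg : IsGenericPoint (tensorCone Unit C) (fun y => x y.2) := by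
      rw [show tensorCone Unit C = (fun (a : ι → ℂ) (y : Unit × ι) =>
        MvPolynomial.aeval a (MvPolynomial.X y.2 : MvPolynomial ι ℂ)) '' C by
          ext w
          constructor
          · rintro ⟨l, v, hv, rfl⟩
            exact ⟨l () • v, hsmul _ _ hv, by ext; simp⟩
          · rintro ⟨v, hv, rfl⟩
            exact ⟨1, v, hv, by ext; simp⟩]
      simpa using hx.image (fun y : Unit × ι => MvPolynomial.X y.2)
    rw [hg.coneTrdeg_eq, hx.coneTrdeg_eq]
    congr 1
    ext z
    simp
  rw [hunit, hmain κ, hmain Unit, Fintype.card_unit]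
  omega

/-- The maximal minors of a matrix given by the tuple of its entries. -/
def tupleMinors {m n : ℕ} (w : Fin m × Fin n → ℂ) : (Fin m ↪o Fin n) → ℂ :=
  maximalMinors (Matrix.of fun i j => w (i, j))

/-- The maximal minors as polynomials in the entries of a matrix. -/
def minorPoly {m n : ℕ} (s : Fin m ↪o Fin n) : MvPolynomial (Fin m × Fin n) ℂ :=
  ((Matrix.mvPolynomialX (Fin m) (Fin n) ℂ).submatrix id s).det

theorem aeval_minorPoly {m n : ℕ} {A : Type} [CommRing A] [Algebra ℂ A] (x : Fin m × Fin n → A)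
    (s : Fin m ↪o Fin n) : MvPolynomial.aeval x (minorPoly s) =
      ((Matrix.of fun i j => x (i, j)).submatrix id s).det := by
  unfold minorPoly
  rw [AlgHom.map_det]
  congr 1
  ext i j
  simp

/-- If a cone of matrices of maximal rank is stable under left multiplication, then the passage
from a matrix to its row space, that is, to its maximal minors, lowers the dimension by
`(k + 1) ^ 2 - 1`. -/
theorem coneTrdeg_minors {k n : ℕ} {Z : Set (Fin (k + 1) × Fin n → ℂ)}
    (hZ : (MvPolynomial.vanishingIdeal ℂ Z).IsPrime)
    (hmul : ∀ y : Fin (k + 1) × Fin (k + 1) → ℂ, ∀ a ∈ Z,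
      (fun x => ∑ l, y (x.1, l) * a (l, x.2)) ∈ Z)
    {a₀ : Fin (k + 1) × Fin n → ℂ} (ha₀ : a₀ ∈ Z) (hne : tupleMinors a₀ ≠ 0) :
    coneTrdeg Z + 1 = coneTrdeg (tupleMinors '' Z) + (k + 1) * (k + 1) := by
  obtain ⟨L, _, _, x, hx⟩ := exists_isGenericPoint hZ
  obtain ⟨s₀, hs₀⟩ := Function.ne_iff.1 hne
  set A : Matrix (Fin (k + 1)) (Fin n) L := Matrix.of fun i j => x (i, j) with hA
  set B := A.submatrix id s₀ with hB
  have hBdet : B.det ≠ 0 := fun h => by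
    have := (hx (minorPoly s₀)).1 (by rw [aeval_minorPoly]; exact h) a₀ ha₀
    rw [aeval_minorPoly] at this
    exact hs₀ this
  have hBu : IsUnit B.det := isUnit_iff_ne_zero.2 hBdet
  set M := B⁻¹ * A with hM
  have hM0 : M.submatrix id s₀ = 1 := by
    rw [hM, Matrix.submatrix_mul _ _ id id s₀ Function.bijective_id, ← hB, Matrix.submatrix_id_id,
      Matrix.nonsing_inv_mul _ hBu]
  let σ := Fin (k + 1) × Fin (k + 1)
  let K := FractionRing (MvPolynomial σ L)
  have hinj : Function.Injective (algebraMap (MvPolynomial σ L) K) := IsFractionRing.injective _ _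
  let U : Matrix (Fin (k + 1)) (Fin (k + 1)) K :=
    (Matrix.mvPolynomialX (Fin (k + 1)) (Fin (k + 1)) L).map (algebraMap (MvPolynomial σ L) K)
  have hU : AlgebraicIndependent L (fun x : σ => U x.1 x.2) :=
    (MvPolynomial.algebraicIndependent_X σ L).map' (f := IsScalarTower.toAlgHom L _ K) hinj
  have hUtr : Transcendental L U.det := by
    have h1 : U.det = IsScalarTower.toAlgHom L (MvPolynomial σ L) K
        (Matrix.mvPolynomialX (Fin (k + 1)) (Fin (k + 1)) L).det := by
      rw [AlgHom.map_det]; rfl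
    rw [h1]
    exact fun h => transcendental_det_mvPolynomialX k ((isAlgebraic_algHom_iff _ hinj).1 h)
  -- the substitution `Y ↦ Y * B⁻¹` turns `Y * A` into `Y * M`
  let φ : MvPolynomial σ L →ₐ[L] K :=
    MvPolynomial.aeval fun x => (U * B⁻¹.map (algebraMap L K)) x.1 x.2
  have hφ : Function.Injective φ :=
    algebraicIndependent_mul_matrix hU (Matrix.mul_nonsing_inv _ hBu)
  let Ψ : Fin (k + 1) × Fin n → MvPolynomial (σ ⊕ Fin (k + 1) × Fin n) ℂ := fun x =>
    ∑ l, MvPolynomial.X (Sum.inl (x.1, l)) * MvPolynomial.X (Sum.inr (l, x.2))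
  have himg : (fun a i => MvPolynomial.aeval a (Ψ i)) ''
      {w : σ ⊕ Fin (k + 1) × Fin n → ℂ | w ∘ Sum.inr ∈ Z} = Z := by
    ext w
    constructor
    · rintro ⟨a, ha, rfl⟩
      simpa [Ψ] using hmul (a ∘ Sum.inl) _ ha
    · intro hw
      refine ⟨Sum.elim (fun x => if x.1 = x.2 then 1 else 0) w, by simpa using hw, ?_⟩
      ext x
      simp [Ψ]
  -- since `Z` is stable under left multiplication, `Y * A` is a generic point of `Z` too
  have hg := ((hx.prod_univ (σ := σ)).image Ψ).map (φ.restrictScalars ℂ) hφ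
  rw [himg] at hg
  have hprod : ∀ y : Fin (k + 1) × Fin n, φ (MvPolynomial.aeval (Sum.elim MvPolynomial.X
      fun i => MvPolynomial.C (x i) : σ ⊕ Fin (k + 1) × Fin n → MvPolynomial σ L) (Ψ y)) =
      (U * M.map (algebraMap L K)) y.1 y.2 := by
    intro y
    rw [hM, Matrix.map_mul, ← Matrix.mul_assoc, Matrix.mul_apply]
    simp only [Ψ, φ, map_sum, map_mul, MvPolynomial.aeval_X, Sum.elim_inl, Sum.elim_inr,
      MvPolynomial.aeval_C]
    rfl
  have hg' : IsGenericPoint Z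
      (fun y : Fin (k + 1) × Fin n => (U * M.map (algebraMap L K)) y.1 y.2) := by
    simpa only [AlgHom.restrictScalars_apply, hprod] using hg
  have hm : IsGenericPoint (tupleMinors '' Z) (fun s : Fin (k + 1) ↪o Fin n =>
      ((U * M.map (algebraMap L K)).submatrix id s).det) := by
    have := hg'.image minorPoly
    simp only [aeval_minorPoly] at this
    exact this
  rw [hg'.coneTrdeg_eq, hm.coneTrdeg_eq, adjoinTrdeg_generic_minors hUtr M s₀ hM0,
    adjoinTrdeg_generic_mul hU (fun h => hUtr (h ▸ isAlgebraic_zero)) M s₀ hM0]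
  ring

end Dimension

/-! ### Irreducibility of powers -/

section Irreducibility

variable {ι : Type*}

theorem vanishingIdeal_isPrime_iff {Z : Set (ι → ℂ)} :
    (MvPolynomial.vanishingIdeal ℂ Z).IsPrime ↔ Z.Nonempty ∧ ∀ f g : MvPolynomial ι ℂ,
      (∃ a ∈ Z, MvPolynomial.eval a f ≠ 0) → (∃ a ∈ Z, MvPolynomial.eval a g ≠ 0) →
        ∃ a ∈ Z, MvPolynomial.eval a f ≠ 0 ∧ MvPolynomial.eval a g ≠ 0 := by
  have hne : MvPolynomial.vanishingIdeal ℂ Z ≠ ⊤ ↔ Z.Nonempty := by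
    rw [Ne, Ideal.eq_top_iff_one, MvPolynomial.mem_vanishingIdeal_iff]
    simp [Set.Nonempty]
  rw [Ideal.isPrime_iff, hne]
  refine and_congr_right fun _ => forall₂_congr fun f g => ?_
  simp only [MvPolynomial.mem_vanishingIdeal_iff, MvPolynomial.aeval_eq_eval, map_mul,
    mul_eq_zero]
  constructor
  · rintro h ⟨a, ha, hfa⟩ ⟨b, hb, hgb⟩
    by_contra! hc
    rcases h fun x hx => or_iff_not_imp_left.2 (hc x hx) with h | h
    · exact hfa (h a ha)
    · exact hgb (h b hb)
  · intro h hfg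
    by_contra! hc
    obtain ⟨a, ha, h1, h2⟩ := h (by simpa using hc.1) (by simpa using hc.2)
    rcases hfg a ha with h | h
    · exact h1 h
    · exact h2 h

/-- A finite power of an irreducible space is irreducible. Irreducibility is expressed by a class
`R` of regular functions, of which any two nonzero ones are nonzero at a common point. Functions
on the power need only be regular in each variable separately. -/
theorem exists_ne_zero_of_regular {X : Type*} (R : Set (X → ℂ))
    (hR : ∀ f ∈ R, ∀ g ∈ R, (∃ x, f x ≠ 0) → (∃ x, g x ≠ 0) → ∃ x, f x ≠ 0 ∧ g x ≠ 0) {m : ℕ} :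
    ∀ f g : (Fin m → X) → ℂ,
      (∀ v j, (fun x => f (Function.update v j x)) ∈ R) →
      (∀ v j, (fun x => g (Function.update v j x)) ∈ R) →
      (∃ v, f v ≠ 0) → (∃ v, g v ≠ 0) → ∃ v, f v ≠ 0 ∧ g v ≠ 0 := by
  induction m with
  | zero =>
    rintro f g - - ⟨v, hv⟩ ⟨w, hw⟩
    exact ⟨v, hv, by rwa [Subsingleton.elim v w]⟩
  | succ m ih =>
    rintro f g hf hg ⟨v, hv⟩ ⟨w, hw⟩
    have hslice : ∀ F : (Fin (m + 1) → X) → ℂ,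
        (∀ v j, (fun x => F (Function.update v j x)) ∈ R) → ∀ (v : Fin (m + 1) → X),
          (fun x => F (Fin.cons x (Fin.tail v) : Fin (m + 1) → X)) ∈ R := by
      intro F hF v
      convert! hF v 0 using 2 with x
      rw [← Fin.cons_self_tail v, Fin.update_cons_zero, Fin.tail_cons]
    obtain ⟨x, hx1, hx2⟩ := hR _ (hslice f hf v) _ (hslice g hg w)
      ⟨v 0, by simpa using hv⟩ ⟨w 0, by simpa using hw⟩
    obtain ⟨u, hu1, hu2⟩ := ih (fun u => f (Fin.cons x u : Fin (m + 1) → X))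
      (fun u => g (Fin.cons x u : Fin (m + 1) → X))
      (fun u j => by simpa only [Fin.cons_update] using hf (Fin.cons x u) j.succ)
      (fun u j => by simpa only [Fin.cons_update] using hg (Fin.cons x u) j.succ)
      ⟨_, hx1⟩ ⟨_, hx2⟩
    exact ⟨_, hu1, hu2⟩

/-- A polynomial on a power restricts to a polynomial in each of its vector variables. -/
theorem exists_eval_update_eq {m : ℕ} (f : MvPolynomial (Fin m × ι) ℂ) (v : Fin m → ι → ℂ)
    (j : Fin m) : ∃ P : MvPolynomial ι ℂ, ∀ x : ι → ℂ,
      MvPolynomial.eval (fun y => Function.update v j x y.1 y.2) f = MvPolynomial.eval x P := by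
  refine ⟨MvPolynomial.aeval (fun y => if y.1 = j then MvPolynomial.X y.2
    else MvPolynomial.C (v y.1 y.2)) f, fun x => ?_⟩
  rw [← MvPolynomial.aeval_eq_eval, ← MvPolynomial.aeval_eq_eval, MvPolynomial.comp_aeval_apply]
  congr 2
  ext y
  by_cases h : y.1 = j
  · simp [h]
  · simp [h]

theorem vanishingIdeal_pow_isPrime {C : Set (ι → ℂ)}
    (hC : (MvPolynomial.vanishingIdeal ℂ C).IsPrime) (m : ℕ) :
    (MvPolynomial.vanishingIdeal ℂ {t : Fin m × ι → ℂ | ∀ j, (fun i => t (j, i)) ∈ C}).IsPrime := by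
  obtain ⟨⟨c, hc⟩, hC⟩ := vanishingIdeal_isPrime_iff.1 hC
  refine vanishingIdeal_isPrime_iff.2 ⟨⟨fun x => c x.2, fun _ => hc⟩, ?_⟩
  let R : Set (C → ℂ) := {f | ∃ P : MvPolynomial ι ℂ, ∀ x : C, f x = MvPolynomial.eval x.1 P}
  have hR : ∀ f ∈ R, ∀ g ∈ R, (∃ x, f x ≠ 0) → (∃ x, g x ≠ 0) → ∃ x, f x ≠ 0 ∧ g x ≠ 0 := by
    rintro f ⟨P, hP⟩ g ⟨Q, hQ⟩ ⟨x, hx⟩ ⟨y, hy⟩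
    obtain ⟨a, ha, h1, h2⟩ := hC P Q ⟨x, x.2, by rwa [← hP]⟩ ⟨y, y.2, by rwa [← hQ]⟩
    exact ⟨⟨a, ha⟩, by rwa [hP], by rwa [hQ]⟩
  have hreg : ∀ (f : MvPolynomial (Fin m × ι) ℂ) (v : Fin m → C) (j : Fin m),
      (fun x => MvPolynomial.eval (fun y => (Function.update v j x y.1).1 y.2) f) ∈ R := by
    intro f v j
    obtain ⟨P, hP⟩ := exists_eval_update_eq f (fun j => (v j).1) j
    have h : ∀ x : C, (fun y : Fin m × ι => (Function.update v j x y.1).1 y.2) =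
        fun y => Function.update (fun j => (v j).1) j x.1 y.1 y.2 := fun x => by
      ext y
      by_cases hy : y.1 = j
      · rw [hy, Function.update_self, Function.update_self]
      · rw [Function.update_of_ne hy, Function.update_of_ne hy]
    simp only [R, Set.mem_ofPred_eq, h, hP]
    exact ⟨P, fun _ => rfl⟩
  rintro f g ⟨a, ha, hfa⟩ ⟨b, hb, hgb⟩
  have hval : ∀ (f : MvPolynomial (Fin m × ι) ℂ) (t : Fin m × ι → ℂ)
      (ht : ∀ j, (fun i => t (j, i)) ∈ C), MvPolynomial.eval t f ≠ 0 →
      ∃ v : Fin m → C, MvPolynomial.eval (fun y => (v y.1).1 y.2) f ≠ 0 :=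
    fun f t ht h => ⟨fun j => ⟨fun i => t (j, i), ht j⟩, h⟩
  obtain ⟨v, h1, h2⟩ := exists_ne_zero_of_regular R hR _ _ (hreg f) (hreg g)
    (hval f a ha hfa) (hval g b hb hgb)
  exact ⟨fun y => (v y.1).1 y.2, fun j => (v j).2, h1, h2⟩

end Irreducibility

/-! ### Affine cones and the Zariski closure -/

section Cones

variable {ι : Type*}

theorem zero_mem_affineCone (X : Set (ℙ ℂ (ι → ℂ))) : (0 : ι → ℂ) ∈ affineCone X :=
  fun h => absurd rfl h

theorem mk_smul {c : ℂ} {v : ι → ℂ} (hcv : c • v ≠ 0) :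
    Projectivization.mk ℂ (c • v) hcv =
      Projectivization.mk ℂ v (fun h => hcv (by rw [h, smul_zero])) := by
  rw [Projectivization.mk_eq_mk_iff']
  exact ⟨c, rfl⟩

theorem smul_mem_affineCone {X : Set (ℙ ℂ (ι → ℂ))} (c : ℂ) {v : ι → ℂ} (hv : v ∈ affineCone X) :
    c • v ∈ affineCone X := fun h => by
  rw [mk_smul h]
  exact hv _

theorem rep_mem_affineCone {X : Set (ℙ ℂ (ι → ℂ))} {p : ℙ ℂ (ι → ℂ)} (hp : p ∈ X) :
    p.rep ∈ affineCone X := fun _ => by rwa [Projectivization.mk_rep]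

theorem affineCone_mono {X Y : Set (ℙ ℂ (ι → ℂ))} (h : X ⊆ Y) : affineCone X ⊆ affineCone Y :=
  fun _ hv h0 => h (hv h0)

theorem exists_smul_rep {X : Set (ℙ ℂ (ι → ℂ))} {v : ι → ℂ} (hv : v ∈ affineCone X) (h0 : v ≠ 0) :
    ∃ p ∈ X, ∃ c : ℂ, v = c • p.rep := by
  obtain ⟨a, ha⟩ := Projectivization.exists_smul_eq_mk_rep ℂ v h0
  refine ⟨_, hv h0, (a⁻¹ : ℂˣ), ?_⟩
  rw [← ha]
  exact (inv_smul_smul a v).symm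

theorem eval_smul_of_isHomogeneous {f : MvPolynomial ι ℂ} {d : ℕ} (hf : f.IsHomogeneous d) (c : ℂ)
    (v : ι → ℂ) : MvPolynomial.eval (c • v) f = c ^ d * MvPolynomial.eval v f := by
  rw [MvPolynomial.eval_eq, MvPolynomial.eval_eq, Finset.mul_sum]
  refine Finset.sum_congr rfl fun m hm => ?_
  have hd : ∑ i ∈ m.support, m i = d := by
    have := hf (MvPolynomial.mem_support_iff.1 hm)
    rwa [show (1 : ι → ℕ) = fun _ => 1 from rfl, ← Finsupp.degree_eq_weight_one] at this
  simp only [Pi.smul_apply, smul_eq_mul, mul_pow, Finset.prod_mul_distrib,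
    Finset.prod_pow_eq_pow_sum, hd]
  ring

/-- The restriction of `f` to the line through `v`: its coefficients are the values at `v` of the
homogeneous components of `f`. -/
def linePoly (f : MvPolynomial ι ℂ) (v : ι → ℂ) : Polynomial ℂ :=
  ∑ d ∈ Finset.range (f.totalDegree + 1),
    Polynomial.monomial d (MvPolynomial.eval v (MvPolynomial.homogeneousComponent d f))

theorem coeff_linePoly (f : MvPolynomial ι ℂ) (v : ι → ℂ) (d : ℕ) :
    (linePoly f v).coeff d = MvPolynomial.eval v (MvPolynomial.homogeneousComponent d f) := by
  simp only [linePoly, Polynomial.finsetSum_coeff, Polynomial.coeff_monomial]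
  rw [Finset.sum_ite_eq']
  split_ifs with h
  · rfl
  · rw [MvPolynomial.homogeneousComponent_eq_zero _ _ (by simpa using h), map_zero]

theorem eval_linePoly (f : MvPolynomial ι ℂ) (v : ι → ℂ) (c : ℂ) :
    (linePoly f v).eval c = MvPolynomial.eval (c • v) f := by
  conv_rhs => rw [← MvPolynomial.sum_homogeneousComponent f]
  rw [map_sum, linePoly, Polynomial.eval_finsetSum]
  refine Finset.sum_congr rfl fun d _ => ?_
  rw [Polynomial.eval_monomial, mul_comm, eval_smul_of_isHomogeneous
    (MvPolynomial.homogeneousComponent_isHomogeneous d f)]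

theorem isClosed_eval_eq_zero {f : MvPolynomial ι ℂ} {d : ℕ} (hf : f.IsHomogeneous d) :
    IsClosed {p : ℙ ℂ (ι → ℂ) | MvPolynomial.eval p.rep f = 0} := by
  rw [← isOpen_compl_iff]
  change IsProjAlgebraic _ᶜᶜ
  rw [compl_compl]
  refine ⟨{f}, ?_, ?_⟩
  · rintro _ rfl
    exact ⟨d, hf⟩
  · ext p
    simp [projZeroLocus]

/-- A set and its Zariski closure have the same homogeneous ideal. -/
theorem vanishingIdeal_affineCone_closure (X : Set (ℙ ℂ (ι → ℂ))) :
    MvPolynomial.vanishingIdeal ℂ (affineCone (closure X)) =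
      MvPolynomial.vanishingIdeal ℂ (affineCone X) := by
  refine le_antisymm (MvPolynomial.vanishingIdeal_anti_mono (affineCone_mono subset_closure)) ?_
  intro f hf v hv
  by_cases h0 : v = 0
  · rw [h0]
    exact hf _ (zero_mem_affineCone X)
  obtain ⟨p, hp, c, rfl⟩ := exists_smul_rep hv h0
  have hline : ∀ q ∈ X, linePoly f q.rep = 0 := fun q hq => Polynomial.funext fun c => by
    rw [eval_linePoly, Polynomial.eval_zero]
    exact hf _ (smul_mem_affineCone c (rep_mem_affineCone hq))
  have hcoeff : linePoly f p.rep = 0 := by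
    ext d
    rw [coeff_linePoly, Polynomial.coeff_zero]
    refine closure_minimal (fun q hq => ?_) (isClosed_eval_eq_zero
      (MvPolynomial.homogeneousComponent_isHomogeneous d f)) hp
    change MvPolynomial.eval q.rep _ = 0
    rw [← coeff_linePoly, hline q hq, Polynomial.coeff_zero]
  change MvPolynomial.eval _ f = 0
  rw [← eval_linePoly, hcoeff, Polynomial.eval_zero]

/-- The homogeneous ideal of an irreducible set is prime. -/
theorem vanishingIdeal_affineCone_isPrime {V : Set (ℙ ℂ (ι → ℂ))} (hV : IsIrreducible V) :
    (MvPolynomial.vanishingIdeal ℂ (affineCone V)).IsPrime := by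
  refine vanishingIdeal_isPrime_iff.2 ⟨⟨0, zero_mem_affineCone V⟩, ?_⟩
  -- a polynomial that is nonzero on the cone has a homogeneous component that is nonzero on `V`
  have hcomp : ∀ f : MvPolynomial ι ℂ, (∃ a ∈ affineCone V, MvPolynomial.eval a f ≠ 0) →
      ∃ d, ∃ p ∈ V, MvPolynomial.eval p.rep (MvPolynomial.homogeneousComponent d f) ≠ 0 := by
    rintro f ⟨a, ha, hfa⟩
    by_contra! hc
    obtain ⟨p, hp, c, rfl⟩ : ∃ p ∈ V, ∃ c : ℂ, a = c • p.rep := by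
      by_cases h0 : a = 0
      · obtain ⟨p, hp⟩ := hV.nonempty
        exact ⟨p, hp, 0, by rw [h0, zero_smul]⟩
      · exact exists_smul_rep ha h0
    have hline : linePoly f p.rep = 0 := by
      ext d
      rw [coeff_linePoly, hc d p hp, Polynomial.coeff_zero]
    rw [← eval_linePoly, hline, Polynomial.eval_zero] at hfa
    exact hfa rfl
  intro f g hf hg
  obtain ⟨d, p, hp, hfp⟩ := hcomp f hf
  obtain ⟨e, q, hq, hgq⟩ := hcomp g hg
  obtain ⟨x, hx, hx1, hx2⟩ := hV.isPreirreducible _ _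
    (isClosed_eval_eq_zero (MvPolynomial.homogeneousComponent_isHomogeneous d f)).isOpen_compl
    (isClosed_eval_eq_zero (MvPolynomial.homogeneousComponent_isHomogeneous e g)).isOpen_compl
    ⟨p, hp, hfp⟩ ⟨q, hq, hgq⟩
  have h1 : linePoly f x.rep ≠ 0 := fun h => hx1 (by
    change MvPolynomial.eval x.rep _ = 0
    rw [← coeff_linePoly, h, Polynomial.coeff_zero])
  have h2 : linePoly g x.rep ≠ 0 := fun h => hx2 (by
    change MvPolynomial.eval x.rep _ = 0
    rw [← coeff_linePoly, h, Polynomial.coeff_zero])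
  -- on the line through a common point of nonvanishing both restrictions are nonzero polynomials
  by_contra! hc
  refine mul_ne_zero h1 h2 (Polynomial.funext fun c => ?_)
  rw [Polynomial.eval_mul, eval_linePoly, eval_linePoly, Polynomial.eval_zero, mul_eq_zero]
  exact or_iff_not_imp_left.2 (hc _ (smul_mem_affineCone c (rep_mem_affineCone hx)))

end Cones

/-! ### The cone of sums of tensors -/

section SecantCone

/-- The sums of `m` tensors `l j ⊗ v j` with `v j ∈ C`, that is, the matrices whose rows are
combinations of `m` vectors of `C`. -/
def secantCone (κ : Type) {ι : Type} (m : ℕ) (C : Set (ι → ℂ)) : Set (κ × ι → ℂ) :=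
  {w | ∃ (l : Fin m → κ → ℂ) (v : Fin m → ι → ℂ), (∀ j, v j ∈ C) ∧
    w = fun y => ∑ j, l j y.1 * v j y.2}

variable {κ ι : Type} {m : ℕ}

/-- The space of the pairs `(l, v)` that parametrize `secantCone κ m C`. -/
def secantParam (κ : Type) {ι : Type} (m : ℕ) (C : Set (ι → ℂ)) : Set (Fin m × (κ ⊕ ι) → ℂ) :=
  {t | ∀ j, (fun i => t (j, i)) ∈ {w : κ ⊕ ι → ℂ | w ∘ Sum.inr ∈ C}}

/-- The entries of `∑ j, l j ⊗ v j` as polynomials in `l` and `v`. -/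
def secantPoly (κ ι : Type) (m : ℕ) (y : κ × ι) : MvPolynomial (Fin m × (κ ⊕ ι)) ℂ :=
  ∑ j, MvPolynomial.X (j, Sum.inl y.1) * MvPolynomial.X (j, Sum.inr y.2)

theorem secantCone_eq_image (C : Set (ι → ℂ)) :
    secantCone κ m C = (fun a y => MvPolynomial.aeval a (secantPoly κ ι m y)) ''
      secantParam κ m C := by
  ext w
  constructor
  · rintro ⟨l, v, hv, rfl⟩
    exact ⟨fun x => Sum.elim (l x.1) (v x.1) x.2, fun j => hv j, by ext; simp [secantPoly]⟩
  · rintro ⟨a, ha, rfl⟩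
    exact ⟨fun j i => a (j, Sum.inl i), fun j i => a (j, Sum.inr i), ha,
      by ext; simp [secantPoly]⟩

theorem secantParam_isPrime {C : Set (ι → ℂ)}
    (hC : (MvPolynomial.vanishingIdeal ℂ C).IsPrime) :
    (MvPolynomial.vanishingIdeal ℂ (secantParam κ m C)).IsPrime := by
  obtain ⟨L, _, _, x, hx⟩ := exists_isGenericPoint hC
  exact vanishingIdeal_pow_isPrime (hx.prod_univ (σ := κ)).isPrime m

theorem secantCone_isPrime {C : Set (ι → ℂ)} (hC : (MvPolynomial.vanishingIdeal ℂ C).IsPrime) :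
    (MvPolynomial.vanishingIdeal ℂ (secantCone κ m C)).IsPrime := by
  obtain ⟨L, _, _, x, hx⟩ := exists_isGenericPoint (secantParam_isPrime (κ := κ) (m := m) hC)
  rw [secantCone_eq_image]
  exact (hx.image (secantPoly κ ι m)).isPrime

theorem linearIndependent_of_maximalMinors_ne_zero {m n : ℕ} {B : Matrix (Fin m) (Fin n) ℂ}
    {s : Fin m ↪o Fin n} (h : maximalMinors B s ≠ 0) : LinearIndependent ℂ B.row := by
  have hu : IsUnit (B.submatrix id s) :=
    (Matrix.isUnit_iff_isUnit_det _).2 (isUnit_iff_ne_zero.2 h)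
  exact LinearIndependent.of_comp (LinearMap.funLeft ℂ ℂ s)
    (Matrix.linearIndependent_rows_iff_isUnit.2 hu)

/-- A polynomial that vanishes at the sums `∑ j, l j ⊗ v j` in general position, with the `v j`
independent and with nonzero `l j`, vanishes on the whole irreducible cone of sums. -/
theorem eval_eq_zero_of_general {k n : ℕ} {C : Set (Fin n → ℂ)}
    (hC : (MvPolynomial.vanishingIdeal ℂ C).IsPrime) {v₀ : Fin m → Fin n → ℂ}
    (hv₀ : ∀ j, v₀ j ∈ C) (hli : LinearIndependent ℂ v₀)
    (f : MvPolynomial (Fin (k + 1) × Fin n) ℂ)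
    (hf : ∀ (l : Fin m → Fin (k + 1) → ℂ) (v : Fin m → Fin n → ℂ), (∀ j, v j ∈ C) →
      LinearIndependent ℂ v → (∀ j, l j 0 ≠ 0) →
        MvPolynomial.eval (fun y => ∑ j, l j y.1 * v j y.2) f = 0)
    {w : Fin (k + 1) × Fin n → ℂ} (hw : w ∈ secantCone (Fin (k + 1)) m C) :
    MvPolynomial.eval w f = 0 := by
  obtain ⟨s, hs⟩ := Function.ne_iff.1 (maximalMinors_ne_zero (Matrix.of v₀) hli)
  -- `D` is a nonzero polynomial on the irreducible parameter space, and where it does not vanish the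
  -- parameters are in general position
  let D : MvPolynomial (Fin m × (Fin (k + 1) ⊕ Fin n)) ℂ :=
    (Matrix.of fun j i => MvPolynomial.X (j, Sum.inr (s i))).det *
      ∏ j, MvPolynomial.X (j, Sum.inl 0)
  have hD : ∀ t : Fin m × (Fin (k + 1) ⊕ Fin n) → ℂ, MvPolynomial.aeval t D =
      maximalMinors (Matrix.of fun j i => t (j, Sum.inr i)) s * ∏ j, t (j, Sum.inl 0) := by
    intro t
    simp only [D, map_mul, map_prod, MvPolynomial.aeval_X]
    rw [AlgHom.map_det]
    congr 2
    ext i j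
    simp
  have hprime := secantParam_isPrime (κ := Fin (k + 1)) (m := m) hC
  have hDmem : D ∉ MvPolynomial.vanishingIdeal ℂ (secantParam (Fin (k + 1)) m C) := by
    intro h
    have := h (fun x => Sum.elim (fun _ => 1) (v₀ x.1) x.2) hv₀
    rw [hD] at this
    simp only [Sum.elim_inr, Sum.elim_inl, Finset.prod_const_one, mul_one] at this
    exact hs this
  have hmul : MvPolynomial.aeval (secantPoly (Fin (k + 1)) (Fin n) m) f * D ∈
      MvPolynomial.vanishingIdeal ℂ (secantParam (Fin (k + 1)) m C) := by
    intro t ht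
    rw [map_mul, hD, mul_eq_zero, or_iff_not_imp_right]
    intro hne
    obtain ⟨h1, h2⟩ := mul_ne_zero_iff.1 hne
    rw [Finset.prod_ne_zero_iff] at h2
    have := hf (fun j i => t (j, Sum.inl i)) (fun j i => t (j, Sum.inr i)) ht
      (linearIndependent_of_maximalMinors_ne_zero h1) (fun j => h2 j (Finset.mem_univ j))
    rw [MvPolynomial.comp_aeval_apply, MvPolynomial.aeval_eq_eval]
    simpa [secantPoly] using this
  rw [secantCone_eq_image] at hw
  obtain ⟨t, ht, rfl⟩ := hw
  have := (hprime.mem_or_mem hmul).resolve_right hDmem t ht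
  rwa [MvPolynomial.comp_aeval_apply, MvPolynomial.aeval_eq_eval] at this

theorem mul_mem_secantCone {C : Set (ι → ℂ)} [Fintype κ] (y : κ × κ → ℂ) {a : κ × ι → ℂ}
    (ha : a ∈ secantCone κ m C) : (fun x => ∑ i, y (x.1, i) * a (i, x.2)) ∈ secantCone κ m C := by
  obtain ⟨l, v, hv, rfl⟩ := ha
  refine ⟨fun j i => ∑ i', y (i, i') * l j i', v, hv, ?_⟩
  ext x
  simp only [Finset.mul_sum, Finset.sum_mul]
  rw [Finset.sum_comm]
  simp only [mul_assoc]

theorem sum_mem_secantCone {C : Set (ι → ℂ)} {q : Fin m → κ × ι → ℂ}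
    (hq : ∀ j, q j ∈ tensorCone κ C) (c : Fin m → ℂ) : ∑ j, c j • q j ∈ secantCone κ m C := by
  choose l v hv hlv using hq
  refine ⟨fun j => c j • l j, v, hv, ?_⟩
  ext y
  simp [hlv, mul_assoc]

end SecantCone

/-! ### The secant variety of the Segre image -/

section Segre

variable {k r : ℕ}

theorem segre_mk {l : Fin (k + 1) → ℂ} {v : Fin (r + 1) → ℂ} (hl : l ≠ 0) (hv : v ≠ 0)
    (hlv : (fun y : Fin (k + 1) × Fin (r + 1) => l y.1 * v y.2) ≠ 0) :
    segre (Projectivization.mk ℂ l hl, Projectivization.mk ℂ v hv) =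
      Projectivization.mk ℂ (fun y => l y.1 * v y.2) hlv := by
  obtain ⟨a, ha⟩ := Projectivization.exists_smul_eq_mk_rep ℂ l hl
  obtain ⟨b, hb⟩ := Projectivization.exists_smul_eq_mk_rep ℂ v hv
  unfold segre
  rw [Projectivization.mk_eq_mk_iff']
  refine ⟨a * b, ?_⟩
  ext y
  simp only [← ha, ← hb, Units.smul_def, Pi.smul_apply, smul_eq_mul]
  ring

/-- The affine cone over `σ(P^k × V)` consists of the tensors `l ⊗ v` with `v` in the cone over `V`. -/
theorem affineCone_segreImage (V : Set (ℙ ℂ (Fin (r + 1) → ℂ))) :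
    affineCone (segreImage k V) = tensorCone (Fin (k + 1)) (affineCone V) := by
  ext w
  constructor
  · intro hw
    by_cases h0 : w = 0
    · exact ⟨0, 0, zero_mem_affineCone V, by ext; simp [h0]⟩
    obtain ⟨⟨a, p⟩, ⟨-, hp⟩, hap⟩ := hw h0
    unfold segre at hap
    rw [Projectivization.mk_eq_mk_iff'] at hap
    obtain ⟨c, hc⟩ := hap
    have hc0 : c ≠ 0 := by
      rintro rfl
      rw [zero_smul] at hc
      exact segre_ne_zero a p hc.symm
    refine ⟨c⁻¹ • a.rep, p.rep, rep_mem_affineCone hp, ?_⟩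
    ext y
    have := congrFun hc y
    simp only [Pi.smul_apply, smul_eq_mul] at this ⊢
    rw [mul_assoc, ← this, inv_mul_cancel_left₀ hc0]
  · rintro ⟨l, v, hv, rfl⟩ h0
    have hl : l ≠ 0 := by
      rintro rfl
      exact h0 (by ext; simp)
    have hv0 : v ≠ 0 := by
      rintro rfl
      exact h0 (by ext; simp)
    exact ⟨(Projectivization.mk ℂ l hl, Projectivization.mk ℂ v hv0), ⟨trivial, hv hv0⟩,
      segre_mk hl hv0 h0⟩

theorem iSup_submodule_eq_span {ι : Type*} {m : ℕ} (q : Fin m → ℙ ℂ (ι → ℂ)) :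
    ⨆ j, (q j).submodule = Submodule.span ℂ (Set.range fun j => (q j).rep) := by
  rw [Submodule.span_range_eq_iSup]
  simp only [Projectivization.submodule_eq]

/-- The cone over the secant variety of `σ(P^k × V)` has the same ideal as the cone of the matrices
whose rows lie in the span of `h + 1` vectors of the cone over `V`. -/
theorem vanishingIdeal_secantVariety {h : ℕ} {V : Set (ℙ ℂ (Fin (r + 1) → ℂ))}
    (hV : (MvPolynomial.vanishingIdeal ℂ (affineCone V)).IsPrime)
    {v₀ : Fin (h + 1) → Fin (r + 1) → ℂ} (hv₀ : ∀ j, v₀ j ∈ affineCone V)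
    (hli : LinearIndependent ℂ v₀) :
    MvPolynomial.vanishingIdeal ℂ (affineCone (secantVariety h (segreImage k V))) =
      MvPolynomial.vanishingIdeal ℂ (secantCone (Fin (k + 1)) (h + 1) (affineCone V)) := by
  unfold secantVariety
  rw [vanishingIdeal_affineCone_closure]
  apply le_antisymm
  · intro f hf w hw
    refine eval_eq_zero_of_general hV hv₀ hli f (fun l v hv hvli hl => hf _ ?_) hw
    have hv0 : ∀ j, v j ≠ 0 := hvli.ne_zero
    have hl0 : ∀ j, l j ≠ 0 := fun j h => hl j (by rw [h]; rfl)
    let u : Fin (h + 1) → Fin (k + 1) × Fin (r + 1) → ℂ := fun j y => l j y.1 * v j y.2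
    have huli : LinearIndependent ℂ u := by
      have h1 := hvli.units_smul fun j => Units.mk0 (l j 0) (hl j)
      exact LinearIndependent.of_comp
        (LinearMap.funLeft ℂ ℂ fun i : Fin (r + 1) => ((0 : Fin (k + 1)), i)) h1
    have hu0 : ∀ j, u j ≠ 0 := huli.ne_zero
    intro hw0
    refine ⟨fun j => Projectivization.mk ℂ (u j) (hu0 j), fun j => ?_,
      Projectivization.Independent.mk u hu0 huli, ?_⟩
    · exact ⟨(Projectivization.mk ℂ (l j) (hl0 j), Projectivization.mk ℂ (v j) (hv0 j)),
        ⟨trivial, hv j (hv0 j)⟩, segre_mk _ _ _⟩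
    · rw [Projectivization.submodule_mk, Submodule.span_singleton_le_iff_mem]
      have : (fun y => ∑ j, l j y.1 * v j y.2) = ∑ j, u j := by ext; simp [u]
      rw [this]
      refine Submodule.sum_mem _ fun j _ => Submodule.mem_iSup_of_mem j ?_
      rw [Projectivization.submodule_mk]
      exact Submodule.mem_span_singleton_self _
  · refine MvPolynomial.vanishingIdeal_anti_mono fun w hw => ?_
    by_cases h0 : w = 0
    · exact ⟨0, 0, fun _ => zero_mem_affineCone V, by ext; simp [h0]⟩
    obtain ⟨q, hq, -, hle⟩ := hw h0
    rw [Projectivization.submodule_mk, Submodule.span_singleton_le_iff_mem,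
      iSup_submodule_eq_span, Submodule.mem_span_range_iff_exists_fun] at hle
    obtain ⟨c, rfl⟩ := hle
    refine sum_mem_secantCone (fun j => ?_) c
    rw [← affineCone_segreImage]
    exact rep_mem_affineCone (hq j)

end Segre

/-! ### The Grassmann secant variety -/

section Grassmannian

variable {k r : ℕ}

theorem maximalMinors_mul {m n : ℕ} (g : Matrix (Fin m) (Fin m) ℂ) (B : Matrix (Fin m) (Fin n) ℂ) :
    maximalMinors (g * B) = g.det • maximalMinors B := by
  ext s
  have h : (g * B).submatrix id s = g * B.submatrix id s := by
    rw [Matrix.submatrix_mul g B id id s Function.bijective_id]; rfl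
  simp only [maximalMinors, Pi.smul_apply, smul_eq_mul]
  rw [h, Matrix.det_mul]

theorem basisMatrix_mem (W : Grass k r) (i : Fin (k + 1)) : basisMatrix W i ∈ W.1 :=
  (Module.finBasisOfFinrankEq ℂ W.1 W.2 i).2

theorem exists_mul_basisMatrix (W : Grass k r) {B : Matrix (Fin (k + 1)) (Fin (r + 1)) ℂ}
    (hB : ∀ i, B i ∈ W.1) : ∃ g : Matrix (Fin (k + 1)) (Fin (k + 1)) ℂ, B = g * basisMatrix W := by
  let b := Module.finBasisOfFinrankEq ℂ W.1 W.2
  refine ⟨Matrix.of fun i j => b.repr ⟨B i, hB i⟩ j, ?_⟩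
  ext i x
  have h1 := congrArg (fun w : W.1 => (w : Fin (r + 1) → ℂ) x) (b.sum_repr ⟨B i, hB i⟩)
  simp only [Submodule.coe_sum, Submodule.coe_smul, Finset.sum_apply, Pi.smul_apply,
    smul_eq_mul] at h1
  rw [← h1, Matrix.mul_apply]
  rfl

theorem plucker_eq_mk (W : Grass k r) {B : Matrix (Fin (k + 1)) (Fin (r + 1)) ℂ}
    (hB : ∀ i, B i ∈ W.1) (h0 : maximalMinors B ≠ 0) :
    plucker W = Projectivization.mk ℂ (maximalMinors B) h0 := by
  obtain ⟨g, rfl⟩ := exists_mul_basisMatrix W hB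
  simp only [maximalMinors_mul] at h0 ⊢
  rw [mk_smul]
  rfl

/-- The cone over the Grassmann secant variety of `V` in its Plücker embedding has the same ideal
as the set of the vectors of maximal minors of the matrices whose rows lie in the span of `h + 1`
vectors of the cone over `V`. -/
theorem vanishingIdeal_grassSecantVariety {h : ℕ} {V : Set (ℙ ℂ (Fin (r + 1) → ℂ))}
    (hV : (MvPolynomial.vanishingIdeal ℂ (affineCone V)).IsPrime)
    {v₀ : Fin (h + 1) → Fin (r + 1) → ℂ} (hv₀ : ∀ j, v₀ j ∈ affineCone V)
    (hli : LinearIndependent ℂ v₀) :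
    MvPolynomial.vanishingIdeal ℂ (affineCone (plucker '' grassSecantVariety k h V)) =
      MvPolynomial.vanishingIdeal ℂ
        (tupleMinors '' secantCone (Fin (k + 1)) (h + 1) (affineCone V)) := by
  unfold grassSecantVariety
  set S : Set (Grass k r) := {W | ∃ q : Fin (h + 1) → ℙ ℂ (Fin (r + 1) → ℂ), (∀ j, q j ∈ V) ∧
    Projectivization.Independent q ∧ W.1 ≤ ⨆ j, (q j).submodule} with hS
  have hcl : MvPolynomial.vanishingIdeal ℂ (affineCone (plucker '' closure S)) =
      MvPolynomial.vanishingIdeal ℂ (affineCone (plucker '' S)) := by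
    apply le_antisymm
    · exact MvPolynomial.vanishingIdeal_anti_mono
        (affineCone_mono (Set.image_mono subset_closure))
    · rw [← vanishingIdeal_affineCone_closure]
      exact MvPolynomial.vanishingIdeal_anti_mono (affineCone_mono
        (image_closure_subset_closure_image continuous_induced_dom))
  rw [hcl]
  apply le_antisymm
  · rintro f hf _ ⟨w, hw, rfl⟩
    have hcomp : ∀ a : Fin (k + 1) × Fin (r + 1) → ℂ,
        MvPolynomial.eval a (MvPolynomial.aeval minorPoly f) =
          MvPolynomial.aeval (tupleMinors a) f := fun a => by
      rw [← MvPolynomial.aeval_eq_eval, MvPolynomial.comp_aeval_apply]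
      simp only [aeval_minorPoly]
      rfl
    rw [← hcomp]
    refine eval_eq_zero_of_general hV hv₀ hli _ (fun l v hv hvli hl => ?_) hw
    rw [hcomp]
    -- if all the minors vanish, they form the vertex of the cone; otherwise the rows are independent
    refine hf _ fun h0 => ?_
    set B : Matrix (Fin (k + 1)) (Fin (r + 1)) ℂ :=
      Matrix.of fun i x => ∑ j, l j i * v j x with hB
    obtain ⟨s, hs⟩ := Function.ne_iff.1 h0
    have hBli : LinearIndependent ℂ B.row := linearIndependent_of_maximalMinors_ne_zero (s := s) hs
    let W : Grass k r := ⟨Submodule.span ℂ (Set.range B.row), by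
      rw [finrank_span_eq_card hBli, Fintype.card_fin]⟩
    have hv0 : ∀ j, v j ≠ 0 := hvli.ne_zero
    refine ⟨W, ⟨fun j => Projectivization.mk ℂ (v j) (hv0 j), fun j => hv j (hv0 j),
      Projectivization.Independent.mk v hv0 hvli, ?_⟩,
      plucker_eq_mk W (fun i => Submodule.subset_span ⟨i, rfl⟩) h0⟩
    refine Submodule.span_le.2 ?_
    rintro _ ⟨i, rfl⟩
    have : B.row i = ∑ j, l j i • v j := by
      ext x
      simp [hB, Matrix.row]
    rw [this]
    refine Submodule.sum_mem _ fun j _ => Submodule.mem_iSup_of_mem j (Submodule.smul_mem _ _ ?_)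
    rw [Projectivization.submodule_mk]
    exact Submodule.mem_span_singleton_self _
  · refine MvPolynomial.vanishingIdeal_anti_mono fun w hw => ?_
    by_cases h0 : w = 0
    · refine ⟨0, ⟨0, 0, fun _ => zero_mem_affineCone V, by ext; simp⟩, ?_⟩
      rw [h0]
      ext s
      exact Matrix.det_zero
    obtain ⟨W, ⟨q, hq, -, hle⟩, hW⟩ := hw h0
    unfold plucker at hW
    rw [Projectivization.mk_eq_mk_iff'] at hW
    obtain ⟨c, hc⟩ := hW
    have hc0 : c ≠ 0 := by
      rintro rfl
      rw [zero_smul] at hc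
      exact maximalMinors_ne_zero _ (basisMatrix_linearIndependent W) hc.symm
    -- the scalar is absorbed by rescaling the first row of the basis matrix
    let g : Matrix (Fin (k + 1)) (Fin (k + 1)) ℂ := Matrix.diagonal fun i => if i = 0 then c⁻¹ else 1
    have hg : g.det = c⁻¹ := by simp [g, Matrix.det_diagonal]
    have hrow : ∀ i, ∃ a : Fin (h + 1) → ℂ, ∑ j, a j • (q j).rep = (g * basisMatrix W) i := by
      intro i
      rw [← Submodule.mem_span_range_iff_exists_fun, ← iSup_submodule_eq_span]
      refine hle ?_
      have : (g * basisMatrix W) i = (if i = 0 then c⁻¹ else 1) • basisMatrix W i := by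
        ext x
        simp [g]
      rw [this]
      exact Submodule.smul_mem _ _ (basisMatrix_mem W i)
    choose a ha using hrow
    refine ⟨fun y => (g * basisMatrix W) y.1 y.2, ⟨fun j i => a i j, fun j => (q j).rep,
      fun j => rep_mem_affineCone (hq j), ?_⟩, ?_⟩
    · ext y
      simp [← ha]
    · change maximalMinors (g * basisMatrix W) = w
      rw [maximalMinors_mul, hg, ← hc, inv_smul_smul₀ hc0]

end Grassmannian

/-! ### Comparison of the dimensions -/

theorem exists_linearIndependent_affineCone {r h : ℕ} {V : Set (ℙ ℂ (Fin (r + 1) → ℂ))}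
    (hV : Nondegenerate V) (hhr : h ≤ r) :
    ∃ v₀ : Fin (h + 1) → Fin (r + 1) → ℂ, (∀ j, v₀ j ∈ affineCone V) ∧ LinearIndependent ℂ v₀ := by
  have hspan : Submodule.span ℂ (affineCone V) = ⊤ := by
    by_contra hne
    obtain ⟨φ, hφ, hle⟩ := Submodule.exists_le_ker_of_lt_top _ (lt_top_iff_ne_top.2 hne)
    obtain ⟨p, hp, hpφ⟩ := hV φ hφ
    exact hpφ (hle (Submodule.subset_span (rep_mem_affineCone hp)))
  obtain ⟨f, hf, -, hli⟩ := Submodule.exists_fun_fin_finrank_span_eq ℂ (affineCone V)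
  have hn : h + 1 ≤ Module.finrank ℂ (Submodule.span ℂ (affineCone V)) := by
    rw [hspan, finrank_top, Module.finrank_fin_fun]
    omega
  exact ⟨f ∘ Fin.castLE hn, fun j => hf _, hli.comp _ (Fin.castLE_injective hn)⟩

theorem projDim_eq_coneTrdeg {ι : Type} {X : Set (ℙ ℂ (ι → ℂ))} {Z : Set (ι → ℂ)}
    (h : MvPolynomial.vanishingIdeal ℂ (affineCone X) = MvPolynomial.vanishingIdeal ℂ Z) :
    projDim X = coneTrdeg Z - 1 := by
  unfold projDim coneTrdeg CoordRing
  rw [h]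

/-- `dim σ(P^k × V) = dim V + k`. -/
theorem projDim_segreImage (k : ℕ) {r : ℕ} {V : Set (ℙ ℂ (Fin (r + 1) → ℂ))}
    (hV : IsIrreducible V) : projDim (segreImage k V) = projDim V + k := by
  obtain ⟨p, hp⟩ := hV.nonempty
  obtain ⟨b, hb⟩ := Function.ne_iff.1 p.rep_nonzero
  have h := coneTrdeg_tensorCone (Fin (k + 1)) (vanishingIdeal_affineCone_isPrime hV)
    (fun c v hv => smul_mem_affineCone c hv) (rep_mem_affineCone hp) hb
  rw [Fintype.card_fin] at h
  rw [projDim_eq_coneTrdeg (congrArg _ (affineCone_segreImage V)), projDim_eq_coneTrdeg rfl]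
  omega

/-- The secant variety of `σ(P^k × V)` is generically a bundle over the Grassmann secant variety of
`V`, whose fibres are open in the projective space of square matrices of size `k + 1`. -/
theorem projDim_secantVariety_segreImage {r k h : ℕ} (hkh : k ≤ h) (hhr : h ≤ r)
    {V : Set (ℙ ℂ (Fin (r + 1) → ℂ))} (hV : IsIrreducible V) (hV' : Nondegenerate V) :
    projDim (secantVariety h (segreImage k V)) =
      grassDim (grassSecantVariety k h V) + ((k + 1) ^ 2 - 1) := by
  have hC := vanishingIdeal_affineCone_isPrime hV
  obtain ⟨v₀, hv₀, hli⟩ := exists_linearIndependent_affineCone hV' hhr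
  have hk : k + 1 ≤ h + 1 := by omega
  have h1 := coneTrdeg_minors (secantCone_isPrime (κ := Fin (k + 1)) (m := h + 1) hC)
    (fun y a ha => mul_mem_secantCone y ha)
    (a₀ := fun y => v₀ (Fin.castLE hk y.1) y.2)
    ⟨fun j i => if Fin.castLE hk i = j then 1 else 0, v₀, hv₀, by ext; simp⟩
    -- this is where `k ≤ h` enters: the matrix with rows `v₀ 0, …, v₀ k` has rank `k + 1`
    (maximalMinors_ne_zero (Matrix.of fun i => v₀ (Fin.castLE hk i))
      (hli.comp _ (Fin.castLE_injective hk)))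
  unfold grassDim
  rw [projDim_eq_coneTrdeg (vanishingIdeal_secantVariety hC hv₀ hli),
    projDim_eq_coneTrdeg (vanishingIdeal_grassSecantVariety hC hv₀ hli)]
  have h2 : ((coneTrdeg (secantCone (Fin (k + 1)) (h + 1) (affineCone V)) : ℕ) : ℤ) + 1 =
      coneTrdeg (tupleMinors '' secantCone (Fin (k + 1)) (h + 1) (affineCone V)) +
        (k + 1) * (k + 1) := by exact_mod_cast h1
  linarith [sq ((k : ℤ) + 1)]

/-- The two expected dimensions differ by `(k + 1) ^ 2 - 1` as well, in both arguments of the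
minimum. -/
theorem expectedSecantDim_segreImage (k h : ℕ) {r : ℕ} {V : Set (ℙ ℂ (Fin (r + 1) → ℂ))}
    (hV : IsIrreducible V) :
    expectedSecantDim h (segreImage k V) =
      expectedGrassSecantDim k h V + ((k + 1) ^ 2 - 1) := by
  unfold expectedSecantDim expectedGrassSecantDim
  rw [projDim_segreImage k hV, ← min_add_add_right]
  simp only [Fintype.card_prod, Fintype.card_fin]
  push_cast
  congr 1 <;> ring

end GrassmannDefect

end

theorem proposition1p3 (r n k h : ℕ) (hkh : k ≤ h) (hhr : h ≤ r)
    (V : Set (Projectivization ℂ (Fin (r + 1) → ℂ)))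
    (hV_closed : IsClosed V) (hV_irred : IsIrreducible V)
    (hV_nondeg : GrassmannDefect.Nondegenerate V) (hV_dim : GrassmannDefect.projDim V = n)
    (δ : ℤ) :
    (GrassmannDefect.IsGrassDefective k h V ∧ GrassmannDefect.grassDefect k h V = δ) ↔
      (GrassmannDefect.IsDefective h (GrassmannDefect.segreImage k V) ∧
        GrassmannDefect.secantDefect h (GrassmannDefect.segreImage k V) = δ) := by
  have h1 := GrassmannDefect.projDim_secantVariety_segreImage hkh hhr hV_irred hV_nondeg
  have h2 := GrassmannDefect.expectedSecantDim_segreImage k h hV_irred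
  unfold GrassmannDefect.IsGrassDefective GrassmannDefect.grassDefect
    GrassmannDefect.IsDefective GrassmannDefect.secantDefect
  rw [h1, h2, add_lt_add_iff_right, add_sub_add_right_eq_sub]
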